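/- **Theorem (Convergence).** Let $A\in\mathbb{R}^{n\times n}$ be symmetric positive definite, $f\in\mathbb{R}^n$, and $F(x)=(\phi_1(x_1),\dots,\phi_n(x_n))^T$, where each $\phi_i:\mathbb{R}\to\mathbb{R}$ is nondecreasing and piecewise $C^2$ (continuous, and $C^2$ up to the endpoints on each of the finitely many closed intervals cut out by a finite set of breakpoints). Put $H(x)=Ax+F(x)-f$ and $\theta(x)=\frac12\|H(x)\|^2$ (Euclidean norm). Let $\tilde F(x,\varepsilon)=(\tilde\phi_1(x_1,\varepsilon),\dots,\tilde\phi_n(x_n,\varepsilon))^T$, $\varepsilon>0$, be *admissible*, i.e. for each $i$: (1) $\tilde\phi_i(\cdot,\varepsilon)\in C^1(\mathbb{R})$ for all $\varepsilon>0$; (2) there is $\mu_i>0$ with $|\tilde\phi_i(t,\varepsilon)-\phi_i(t)|\le\mu_i\varepsilon$ for all $t\in\mathbb{R}$, $\varepsilon>0$; (3) $\tilde\phi_i(\cdot,\varepsilon)$ is nondecreasing for all $\varepsilon>0$; (4) for each $t\in\mathbb{R}$ there are $\varepsilon_0>0$ and, for $0<\varepsilon<\varepsilon_0$, numbers $\delta_1(\varepsilon),\delta_2(\varepsilon)\ge0$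 tending to $0$ as $\varepsilon\to0^+$, such that $\phi_i$ is differentiable at $t-\delta_1(\varepsilon)$ and $t+\delta_2(\varepsilon)$ and $\partial_t\tilde\phi_i(t,\varepsilon)\in\operatorname{co}\{\phi_i'(t-\delta_1(\varepsilon)),\phi_i'(t+\delta_2(\varepsilon))\}$. Put $\tilde H(x,\varepsilon)=Ax+\tilde F(x,\varepsilon)-f$, and let $\partial_CH(x)$ be Qi's C-subdifferential: the set of matrices whose $i$-th row lies in $\operatorname{co}\,\partial_BH_i(x)$ for every $i$, where $\partial_BH_i(x)$ is the set of limits of $H_i'(y^k)$ along sequences $y^k\to x$ of differentiability points of $H_i$. Distances of matrices are taken in the operator norm. *Algorithm.* Given $\rho,\alpha,\eta\in(0,1)$, $\gamma>0$, $\sigma\in(0,\frac12(1-\alpha))$, $\mu>0$ with $\|\tilde H(x,\varepsilon)-H(x)\|\le\mu\varepsilon$ for all $x\in\mathbb{R}^n$ and $\varepsilon>0$, and $x^0\in\mathbb{R}^n$: set $\beta_0=\|H(x^0)\|$, $\varepsilon^0=\frac{\alpha}{2\mu}\beta_0$, and terminate at once if $H(x^0)=0$. For $k=0,1,2,\dots$: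 (i) solve $H(x^k)+\tilde H'_x(x^k,\varepsilon^k)d^k=0$ for $d^k$; (ii) with $\theta_k(x)=\frac12\|\tilde H(x,\varepsilon^k)\|^2$, let $m_k$ be the smallest integer $m\ge0$ with $\theta_k(x^k+\rho^md^k)-\theta_k(x^k)\le-2\sigma\rho^m\theta(x^k)$, and set $x^{k+1}=x^k+\rho^{m_k}d^k$; (iii) if $H(x^{k+1})=0$, terminate; otherwise, if $\|H(x^{k+1})\|\le\max\{\eta\beta_k,\ \alpha^{-1}\|H(x^{k+1})-\tilde H(x^{k+1},\varepsilon^k)\|\}$, set $\beta_{k+1}=\|H(x^{k+1})\|$ and choose any $\varepsilon^{k+1}$ with $0<\varepsilon^{k+1}\le\min\{\frac{\alpha}{2\mu}\beta_{k+1},\frac{\varepsilon^k}{2}\}$ and $\operatorname{dist}(\tilde H'_x(x^{k+1},\varepsilon^{k+1}),\partial_CH(x^{k+1}))\le\gamma\beta_{k+1}$; if the test fails, set $\beta_{k+1}=\beta_k$, $\varepsilon^{k+1}=\varepsilon^k$. *Conclusion.* A constant $\mu$ as required exists, and $H(x)=0$ has a unique solution $x^*$. For all admitted constants and every $x^0\in\mathbb{R}^n$,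 the algorithm is well defined: at every iterate that it can reach without having terminated, $\varepsilon^k>0$, the linear system (i) has exactly one solution, the line search (ii) ends, and a parameter $\varepsilon^{k+1}$ as in (iii) exists whenever it has to be chosen. Every sequence $\{x^k\}$ that it generates (continued by its last element if the algorithm terminates) converges to $x^*$, and the convergence is Q-quadratic: there is a constant $C$ with $\|x^{k+1}-x^*\|\le C\|x^k-x^*\|^2$ for all sufficiently large $k$. -/

import Mathlib

open Filter Topology

noncomputable section

namespace SmoothingNewton

/-! ### The nonsmooth problem and its smoothings -/

/-- `φ : ℝ → ℝ` is piecewise `C^k` with finitely many pieces: it is continuous, and there is a finite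
set of breakpoints such that `φ` is `C^k`, up to the endpoints, on every compact interval whose
interior contains no breakpoint. -/
def PiecewiseContDiff (k : ℕ) (φ : ℝ → ℝ) : Prop :=
  Continuous φ ∧ ∃ S : Finset ℝ, ∀ a b : ℝ, a < b → (∀ s ∈ S, s ∉ Set.Ioo a b) →
    ContDiffOn ℝ k φ (Set.Icc a b)

/-- Admissibility of the smoothing `ψ t ε` of a scalar function `φ`. -/
structure IsAdmissible (φ : ℝ → ℝ) (ψ : ℝ → ℝ → ℝ) : Prop where
  smooth : ∀ ε : ℝ, 0 < ε → ContDiff ℝ 1 (fun t => ψ t ε)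
  approx : ∃ μ : ℝ, 0 < μ ∧ ∀ t ε : ℝ, 0 < ε → |ψ t ε - φ t| ≤ μ * ε
  monotone : ∀ ε : ℝ, 0 < ε → Monotone (fun t => ψ t ε)
  /-- The intermediate slope property; the derivatives of `φ` which occur in it exist. -/
  slope : ∀ t : ℝ, ∃ ε₀ : ℝ, 0 < ε₀ ∧ ∃ δ₁ δ₂ : ℝ → ℝ,
    Tendsto δ₁ (𝓝[>] 0) (𝓝 0) ∧ Tendsto δ₂ (𝓝[>] 0) (𝓝 0) ∧
    ∀ ε : ℝ, 0 < ε → ε < ε₀ → 0 ≤ δ₁ ε ∧ 0 ≤ δ₂ ε ∧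
      DifferentiableAt ℝ φ (t - δ₁ ε) ∧ DifferentiableAt ℝ φ (t + δ₂ ε) ∧
      deriv (fun s => ψ s ε) t ∈
        convexHull ℝ {deriv φ (t - δ₁ ε), deriv φ (t + δ₂ ε)}

variable {n : ℕ}

/-- The map `x ↦ A x + (φ₁(x₁), …, φₙ(xₙ)) - f` on Euclidean space. -/
def residual (A : Matrix (Fin n) (Fin n) ℝ) (φ : Fin n → ℝ → ℝ) (f : EuclideanSpace ℝ (Fin n))
    (x : EuclideanSpace ℝ (Fin n)) : EuclideanSpace ℝ (Fin n) :=
  Matrix.toEuclideanCLM (𝕜 := ℝ) A x + WithLp.toLp 2 (fun i => φ i (x i)) - f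

/-- The map `(x, ε) ↦ A x + (ψ₁(x₁, ε), …, ψₙ(xₙ, ε)) - f`. -/
def smoothResidual (A : Matrix (Fin n) (Fin n) ℝ) (ψ : Fin n → ℝ → ℝ → ℝ)
    (f : EuclideanSpace ℝ (Fin n)) (x : EuclideanSpace ℝ (Fin n)) (ε : ℝ) :
    EuclideanSpace ℝ (Fin n) :=
  residual A (fun i t => ψ i t ε) f x

/-! ### Generalized derivatives -/

/-- The B-subdifferential of a scalar function: all limits of derivatives along sequences of
differentiability points converging to `x`. -/
def bSubdifferential (g : EuclideanSpace ℝ (Fin n) → ℝ) (x : EuclideanSpace ℝ (Fin n)) :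
    Set (EuclideanSpace ℝ (Fin n) →L[ℝ] ℝ) :=
  {L | ∃ y : ℕ → EuclideanSpace ℝ (Fin n), Tendsto y atTop (𝓝 x) ∧
    (∀ k, DifferentiableAt ℝ g (y k)) ∧ Tendsto (fun k => fderiv ℝ g (y k)) atTop (𝓝 L)}

/-- Qi's C-subdifferential: all linear maps whose `i`-th row lies in the convex hull of the
B-subdifferential of the `i`-th component, for every `i`. -/
def cSubdifferential (H : EuclideanSpace ℝ (Fin n) → EuclideanSpace ℝ (Fin n))
    (x : EuclideanSpace ℝ (Fin n)) :
    Set (EuclideanSpace ℝ (Fin n) →L[ℝ] EuclideanSpace ℝ (Fin n)) :=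
  {V | ∀ i, (EuclideanSpace.proj i : EuclideanSpace ℝ (Fin n) →L[ℝ] ℝ).comp V ∈
    convexHull ℝ (bSubdifferential (fun z => H z i) x)}

/-! ### The damped Jacobian smoothing Newton algorithm -/

/-- The constants of the algorithm. -/
structure Params where
  ρ : ℝ
  α : ℝ
  η : ℝ
  γ : ℝ
  σ : ℝ
  μ : ℝ

/-- `μ` bounds the smoothing error of `Ht` with respect to `H`. -/
def IsSmoothingConstant (H : EuclideanSpace ℝ (Fin n) → EuclideanSpace ℝ (Fin n))
    (Ht : EuclideanSpace ℝ (Fin n) → ℝ → EuclideanSpace ℝ (Fin n)) (μ : ℝ) : Prop :=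
  0 < μ ∧ ∀ (x : EuclideanSpace ℝ (Fin n)) (ε : ℝ), 0 < ε → ‖Ht x ε - H x‖ ≤ μ * ε

/-- The constraints on the constants of the algorithm. -/
structure Params.Valid (p : Params) (H : EuclideanSpace ℝ (Fin n) → EuclideanSpace ℝ (Fin n))
    (Ht : EuclideanSpace ℝ (Fin n) → ℝ → EuclideanSpace ℝ (Fin n)) : Prop where
  ρ_mem : p.ρ ∈ Set.Ioo (0 : ℝ) 1
  α_mem : p.α ∈ Set.Ioo (0 : ℝ) 1
  η_mem : p.η ∈ Set.Ioo (0 : ℝ) 1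
  γ_pos : 0 < p.γ
  σ_mem : p.σ ∈ Set.Ioo (0 : ℝ) (1 / 2 * (1 - p.α))
  μ_spec : IsSmoothingConstant H Ht p.μ

/-- The data `x^k`, `β_k`, `ε^k` carried by the algorithm. -/
structure State (n : ℕ) where
  x : EuclideanSpace ℝ (Fin n)
  β : ℝ
  ε : ℝ

/-- Half the squared norm. -/
def merit (G : EuclideanSpace ℝ (Fin n) → EuclideanSpace ℝ (Fin n))
    (x : EuclideanSpace ℝ (Fin n)) : ℝ :=
  1 / 2 * ‖G x‖ ^ 2

section Algorithm

variable (p : Params) (H : EuclideanSpace ℝ (Fin n) → EuclideanSpace ℝ (Fin n))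
  (Ht : EuclideanSpace ℝ (Fin n) → ℝ → EuclideanSpace ℝ (Fin n))

/-- The initial state for the initial guess `x₀`. -/
def initState (x₀ : EuclideanSpace ℝ (Fin n)) : State n where
  x := x₀
  β := ‖H x₀‖
  ε := p.α / (2 * p.μ) * ‖H x₀‖

/-- `d` solves the linearized problem at the state `s`. -/
def IsNewtonDirection (s : State n) (d : EuclideanSpace ℝ (Fin n)) : Prop :=
  H s.x + fderiv ℝ (fun y => Ht y s.ε) s.x d = 0

/-- The line search condition for the exponent `m`. -/
def LineSearchCond (s : State n) (d : EuclideanSpace ℝ (Fin n)) (m : ℕ) : Prop :=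
  merit (fun y => Ht y s.ε) (s.x + p.ρ ^ m • d) - merit (fun y => Ht y s.ε) s.x ≤
    -2 * p.σ * p.ρ ^ m * merit H s.x

/-- `x'` is the next iterate: the step along the Newton direction with the least exponent that
satisfies the line search condition. -/
def IsNextIterate (s : State n) (x' : EuclideanSpace ℝ (Fin n)) : Prop :=
  ∃ (d : EuclideanSpace ℝ (Fin n)) (m : ℕ), IsNewtonDirection H Ht s d ∧
    IsLeast {j : ℕ | LineSearchCond p H Ht s d j} m ∧ x' = s.x + p.ρ ^ m • d

/-- The test that decides whether the smoothing parameter is decreased. -/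
def DecreaseTest (s : State n) (x' : EuclideanSpace ℝ (Fin n)) : Prop :=
  ‖H x'‖ ≤ max (p.η * s.β) (p.α⁻¹ * ‖H x' - Ht x' s.ε‖)

/-- The requirements on the new smoothing parameter `e` when it is decreased. -/
def IsNewParameter (s : State n) (x' : EuclideanSpace ℝ (Fin n)) (e : ℝ) : Prop :=
  0 < e ∧ e ≤ min (p.α / (2 * p.μ) * ‖H x'‖) (s.ε / 2) ∧
    Metric.infDist (fderiv ℝ (fun y => Ht y e) x') (cSubdifferential H x') ≤ p.γ * ‖H x'‖

/-- One pass of the algorithm from the state `s` to the state `s'`; there is none if the algorithm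
has terminated at `s`. On termination at `s'.x` the values `s'.β`, `s'.ε` are not used any more. -/
def Step (s s' : State n) : Prop :=
  H s.x ≠ 0 ∧ IsNextIterate p H Ht s s'.x ∧
    ((H s'.x ≠ 0 ∧ DecreaseTest p H Ht s s'.x ∧
        s'.β = ‖H s'.x‖ ∧ IsNewParameter p H Ht s s'.x s'.ε) ∨
      ((H s'.x = 0 ∨ ¬ DecreaseTest p H Ht s s'.x) ∧ s'.β = s.β ∧ s'.ε = s.ε))

/-- The algorithm is well defined from `x₀`: at every state that it can reach without having
terminated, the smoothing parameter is positive, the smoothed map is differentiable, the linearized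
problem has exactly one solution, the line search ends, and a new smoothing parameter as required
exists whenever one has to be chosen. -/
def WellDefined (x₀ : EuclideanSpace ℝ (Fin n)) : Prop :=
  ∀ s : State n, Relation.ReflTransGen (Step p H Ht) (initState p H x₀) s → H s.x ≠ 0 →
    0 < s.ε ∧ DifferentiableAt ℝ (fun y => Ht y s.ε) s.x ∧
    (∃! d, IsNewtonDirection H Ht s d) ∧
    (∀ d, IsNewtonDirection H Ht s d → ∃ m, LineSearchCond p H Ht s d m) ∧
    (∀ x', IsNextIterate p H Ht s x' → H x' ≠ 0 → DecreaseTest p H Ht s x' →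
      ∃ e, IsNewParameter p H Ht s x' e)

/-- `s` is a run of the algorithm from `x₀`, continued as a constant sequence after termination. -/
def IsRun (x₀ : EuclideanSpace ℝ (Fin n)) (s : ℕ → State n) : Prop :=
  s 0 = initState p H x₀ ∧
    ∀ k, Step p H Ht (s k) (s (k + 1)) ∨ (H (s k).x = 0 ∧ s (k + 1) = s k)

end Algorithm

end SmoothingNewton

end

noncomputable section

namespace SmoothingNewton

variable {n : ℕ}

/-! Coercivity of `A` together with monotone diagonal terms makes `H` and every smoothed map
expanding with one constant `c`, and gives every smoothed Jacobian the lower bound `c`. All linear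
systems are thus uniformly invertible, the zero of `H` is unique, and it exists because the smoothed
maps have zeros and approximate `H` uniformly. `IsRegularSmoothing` collects what the analysis of
the algorithm needs; `isRegularSmoothing_residual` verifies it.

Global convergence: while the smoothing error is at most `α * ‖H x‖`, the Newton direction is a
descent direction for the smoothed merit function, so the line search ends. If the smoothing
parameter were eventually frozen, the accepted step lengths would tend to zero, and the rejected
trial steps would contradict descent at an accumulation point
(`IsInfiniteRun.frequently_decreases`). Hence `β` contracts by a fixed factor infinitely often and
tends to zero. Since `‖H x‖ ≤ (1 + α) * β` always holds, the expansion inequality gives convergence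
of the iterates.

Local rate: for a piecewise `C²` function, elements of the C-subdifferential at `x` reproduce `H x -
H xs` up to a quadratic error. When the parameter has just been adapted, the smoothed Jacobian is
within `O(‖H x‖)` of such an element, so a full Newton step has quadratic error. Close to the
solution this step is accepted and passes the decrease test again, so the situation perpetuates
itself (`IsRegularSmoothing.exists_quadratic_step`). -/

/-- The properties of a map and of its smoothing on which the convergence of the algorithm rests. -/
structure IsRegularSmoothing (H : EuclideanSpace ℝ (Fin n) → EuclideanSpace ℝ (Fin n))
    (Ht : EuclideanSpace ℝ (Fin n) → ℝ → EuclideanSpace ℝ (Fin n)) (c : ℝ) : Prop where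
  c_pos : 0 < c
  continuous : Continuous H
  expand : ∀ x y, c * ‖x - y‖ ≤ ‖H x - H y‖
  contDiff : ∀ ε : ℝ, 0 < ε → ContDiff ℝ 1 (fun y => Ht y ε)
  expand_smooth : ∀ ε : ℝ, 0 < ε → ∀ x y, c * ‖x - y‖ ≤ ‖Ht x ε - Ht y ε‖
  expand_fderiv : ∀ ε : ℝ, 0 < ε → ∀ x d, c * ‖d‖ ≤ ‖fderiv ℝ (fun y => Ht y ε) x d‖
  nonempty : ∀ x, (cSubdifferential H x).Nonempty
  consistent : ∀ x, ∀ r : ℝ, 0 < r → ∃ e₀ : ℝ, 0 < e₀ ∧ ∀ e : ℝ, 0 < e → e < e₀ →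
    Metric.infDist (fderiv ℝ (fun y => Ht y e) x) (cSubdifferential H x) ≤ r
  semismooth : ∀ z, ∃ r K : ℝ, 0 < r ∧ 0 < K ∧ ∀ x, ‖x - z‖ < r →
    ‖H x - H z‖ ≤ K * ‖x - z‖ ∧
    ∀ V ∈ cSubdifferential H x, ‖V (x - z) - (H x - H z)‖ ≤ K * ‖x - z‖ ^ 2

/-! ### Expanding maps, limits of difference quotients, and zeros. -/

section General

variable {E F : Type*} [NormedAddCommGroup E] [NormedSpace ℝ E] [NormedAddCommGroup F]

theorem bijective_of_expanding [FiniteDimensional ℝ E] {L : E →L[ℝ] E} {c : ℝ} (hc : 0 < c)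
    (h : ∀ d, c * ‖d‖ ≤ ‖L d‖) : Function.Bijective L := by
  have hinj : Function.Injective L := by
    refine (injective_iff_map_eq_zero L).2 fun d hd => ?_
    have h1 := h d
    rw [hd, norm_zero] at h1
    exact norm_le_zero_iff.1 (nonpos_of_mul_nonpos_right h1 hc)
  exact ⟨hinj, (LinearMap.injective_iff_surjective (f := (L : E →ₗ[ℝ] E))).1 hinj⟩

theorem exists_forall_norm_le_of_expanding [FiniteDimensional ℝ E] {G : E → F}
    (hG : Continuous G) {c : ℝ} (hc : 0 < c) (h : ∀ x y, c * ‖x - y‖ ≤ ‖G x - G y‖) :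
    ∃ x, ∀ y, ‖G x‖ ≤ ‖G y‖ := by
  refine hG.norm.exists_forall_le ?_
  have h1 : Tendsto (fun y : E => c * ‖y‖ - ‖G 0‖) (cocompact E) atTop :=
    tendsto_atTop_add_const_right _ _ ((tendsto_norm_cocompact_atTop).const_mul_atTop hc)
  refine tendsto_atTop_mono (fun y => ?_) h1
  have h2 := h y 0
  rw [sub_zero] at h2
  linarith [norm_sub_le (G y) (G 0)]

/-- The difference quotients of a strictly differentiable function along moving base points and
moving directions. -/
theorem tendsto_slope_of_hasStrictFDerivAt {g : E → ℝ} {g' : E →L[ℝ] ℝ} {x d : E}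
    (hg : HasStrictFDerivAt g g' x) {u v : ℕ → E} {t : ℕ → ℝ} (hu : Tendsto u atTop (𝓝 x))
    (hv : Tendsto v atTop (𝓝 d)) (ht : Tendsto t atTop (𝓝 0)) (ht0 : ∀ᶠ k in atTop, 0 < t k) :
    Tendsto (fun k => (g (u k + t k • v k) - g (u k)) / t k) atTop (𝓝 (g' d)) := by
  have htv : Tendsto (fun k => u k + t k • v k) atTop (𝓝 x) := by
    simpa using hu.add (ht.smul hv)
  have h1 := hg.isLittleO.comp_tendsto (htv.prodMk_nhds hu)
  have h2 : (fun k => g (u k + t k • v k) - g (u k) - g' (t k • v k)) =o[atTop]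
      (fun k => t k • v k) := by
    simpa [Function.comp_def] using h1
  have h3 : (fun k => t k • v k) =O[atTop] t := by
    have h4 : v =O[atTop] (fun _ => (1 : ℝ)) := hv.isBigO_one ℝ
    simpa using (Asymptotics.isBigO_refl t atTop).smul h4
  have h5 := (h2.trans_isBigO h3).tendsto_div_nhds_zero
  have h6 : Tendsto (fun k => g' (v k)) atTop (𝓝 (g' d)) := (g'.continuous.tendsto d).comp hv
  have h7 := h5.add h6
  rw [zero_add] at h7
  refine h7.congr' ?_
  filter_upwards [ht0] with k hk
  simp only [map_smul, smul_eq_mul]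
  field_simp
  ring

theorem tendsto_clm_apply {G : Type*} [NormedAddCommGroup G] [NormedSpace ℝ G]
    {L : ℕ → E →L[ℝ] G} {L' : E →L[ℝ] G} {v : ℕ → E} {v' : E}
    (hL : Tendsto L atTop (𝓝 L')) (hv : Tendsto v atTop (𝓝 v')) :
    Tendsto (fun k => L k (v k)) atTop (𝓝 (L' v')) :=
  ((isBoundedBilinearMap_apply (𝕜 := ℝ) (E := E) (F := G)).continuous.tendsto (L', v')).comp
    (hL.prodMk_nhds hv)

end General

theorem hasStrictFDerivAt_merit {G : EuclideanSpace ℝ (Fin n) → EuclideanSpace ℝ (Fin n)}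
    (hG : ContDiff ℝ 1 G) (x : EuclideanSpace ℝ (Fin n)) :
    HasStrictFDerivAt (merit G) ((innerSL ℝ (G x)).comp (fderiv ℝ G x)) x := by
  have h := ((hasStrictFDerivAt_norm_sq (G x)).comp x
    ((hG.contDiffAt (x := x)).hasStrictFDerivAt one_ne_zero)).const_mul (1 / 2 : ℝ)
  refine h.congr_fderiv ?_
  ext d
  simp

/-- Expansion makes the norm coercive, so it has a minimizer. Criticality says that `G x` is
orthogonal to the range of the derivative there, and this range is the whole space. -/
theorem exists_zero_of_contDiff_of_expanding
    {G : EuclideanSpace ℝ (Fin n) → EuclideanSpace ℝ (Fin n)} (hG : ContDiff ℝ 1 G) {c : ℝ}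
    (hc : 0 < c) (h : ∀ x y, c * ‖x - y‖ ≤ ‖G x - G y‖)
    (h' : ∀ x d, c * ‖d‖ ≤ ‖fderiv ℝ G x d‖) : ∃ x, G x = 0 := by
  obtain ⟨x, hx⟩ := exists_forall_norm_le_of_expanding hG.continuous hc h
  have hmin : IsLocalMin (merit G) x := by
    refine Eventually.of_forall fun y => ?_
    unfold merit
    have := hx y
    gcongr
  have h0 := hmin.hasFDerivAt_eq_zero (hasStrictFDerivAt_merit hG x).hasFDerivAt
  obtain ⟨d, hd⟩ := (bijective_of_expanding hc (h' x)).2 (G x)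
  have h1 := DFunLike.congr_fun h0 d
  refine ⟨x, ?_⟩
  simpa [hd] using h1

namespace IsRegularSmoothing

variable {p : Params} {H : EuclideanSpace ℝ (Fin n) → EuclideanSpace ℝ (Fin n)}
  {Ht : EuclideanSpace ℝ (Fin n) → ℝ → EuclideanSpace ℝ (Fin n)} {c : ℝ}

/-- `H` need not be differentiable at its norm minimizer, so criticality is not available. Instead
the zero of the smoothed map with parameter `r / μ` has `‖H y‖ ≤ r`, which forces the minimal norm
to be zero. -/
theorem exists_zero (h : IsRegularSmoothing H Ht c) {μ : ℝ} (hμ : IsSmoothingConstant H Ht μ) :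
    ∃ x, H x = 0 := by
  obtain ⟨x, hx⟩ := exists_forall_norm_le_of_expanding h.continuous h.c_pos h.expand
  refine ⟨x, norm_le_zero_iff.1 (le_of_forall_pos_le_add fun r hr => ?_)⟩
  obtain ⟨y, hy⟩ := exists_zero_of_contDiff_of_expanding (h.contDiff (r / μ) (div_pos hr hμ.1))
    h.c_pos (h.expand_smooth _ (div_pos hr hμ.1)) (h.expand_fderiv _ (div_pos hr hμ.1))
  have h1 := hμ.2 y (r / μ) (div_pos hr hμ.1)
  rw [hy, zero_sub, norm_neg, mul_div_cancel₀ _ hμ.1.ne'] at h1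
  linarith [hx y]

theorem eq_of_zero (h : IsRegularSmoothing H Ht c) {x y : EuclideanSpace ℝ (Fin n)}
    (hx : H x = 0) (hy : H y = 0) : y = x := by
  have h1 := h.expand y x
  rw [hx, hy, sub_zero, norm_zero] at h1
  exact sub_eq_zero.1 (norm_le_zero_iff.1 (nonpos_of_mul_nonpos_right h1 h.c_pos))

theorem existsUnique_isNewtonDirection (h : IsRegularSmoothing H Ht c) {s : State n}
    (hε : 0 < s.ε) : ∃! d, IsNewtonDirection H Ht s d := by
  obtain ⟨d, hd, hu⟩ :=
    (bijective_of_expanding h.c_pos (h.expand_fderiv s.ε hε s.x)).existsUnique (-H s.x)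
  refine ⟨d, ?_, fun e he => hu e ?_⟩
  · simp only [IsNewtonDirection, hd, add_neg_cancel]
  · exact (neg_eq_of_add_eq_zero_right he).symm

theorem norm_isNewtonDirection_le (h : IsRegularSmoothing H Ht c) {s : State n} (hε : 0 < s.ε)
    {d : EuclideanSpace ℝ (Fin n)} (hd : IsNewtonDirection H Ht s d) : c * ‖d‖ ≤ ‖H s.x‖ := by
  have h1 := h.expand_fderiv s.ε hε s.x d
  rwa [← neg_eq_of_add_eq_zero_right hd, norm_neg] at h1

end IsRegularSmoothing

/-! ### Descent, invariants and well-definedness. -/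

/-- A Newton direction is a direction of sufficient descent when the smoothing error is small
relative to the residual. -/
theorem inner_lt_of_norm_sub_le {E : Type*} [NormedAddCommGroup E] [InnerProductSpace ℝ E]
    {h g v : E} {α σ : ℝ} (hσ : σ < 1 / 2 * (1 - α)) (hα : α < 1) (h0 : h ≠ 0)
    (hg : ‖h - g‖ ≤ α * ‖h‖) (hv : h + v = 0) : inner ℝ g v < -2 * σ * (1 / 2 * ‖h‖ ^ 2) := by
  have hv' : v = -h := (neg_eq_of_add_eq_zero_right hv).symm
  -- This identity and Cauchy–Schwarz bound the slope by `-(1 - α) * ‖h‖ ^ 2`, and `σ < 1 - α`.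
  have h1 : inner ℝ g v = inner ℝ (h - g) h - ‖h‖ ^ 2 := by
    rw [hv', inner_neg_right, inner_sub_left, real_inner_self_eq_norm_sq]; ring
  have h2 := real_inner_le_norm (h - g) h
  have h3 : 0 < ‖h‖ := norm_pos_iff.2 h0
  rw [h1]
  nlinarith [mul_le_mul_of_nonneg_right hg h3.le, pow_pos h3 2]

/-- The properties that all states of the algorithm share. -/
structure Invariant (p : Params) (H : EuclideanSpace ℝ (Fin n) → EuclideanSpace ℝ (Fin n))
    (Ht : EuclideanSpace ℝ (Fin n) → ℝ → EuclideanSpace ℝ (Fin n)) (s : State n) : Prop where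
  ε_pos : 0 < s.ε
  β_pos : 0 < s.β
  ε_le : p.μ * s.ε ≤ p.α / 2 * s.β
  norm_le : ‖Ht s.x s.ε‖ ≤ (1 + p.α / 2) * s.β
  error_le : H s.x ≠ 0 → ‖H s.x - Ht s.x s.ε‖ ≤ p.α * ‖H s.x‖

section Steps

variable {p : Params} {H : EuclideanSpace ℝ (Fin n) → EuclideanSpace ℝ (Fin n)}
  {Ht : EuclideanSpace ℝ (Fin n) → ℝ → EuclideanSpace ℝ (Fin n)} {c : ℝ}

theorem Params.Valid.error_le (hp : p.Valid H Ht) {ε : ℝ} (hε : 0 < ε)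
    (x : EuclideanSpace ℝ (Fin n)) : ‖H x - Ht x ε‖ ≤ p.μ * ε := by
  rw [norm_sub_rev]; exact hp.μ_spec.2 x ε hε

theorem Params.Valid.mul_le_of_le (hp : p.Valid H Ht) {e b : ℝ} (h : e ≤ p.α / (2 * p.μ) * b) :
    p.μ * e ≤ p.α / 2 * b := by
  have hμ := hp.μ_spec.1
  calc p.μ * e ≤ p.μ * (p.α / (2 * p.μ) * b) := by gcongr
    _ = p.α / 2 * b := by field_simp

theorem Invariant.of_fresh (hp : p.Valid H Ht) {s : State n} (hH : H s.x ≠ 0)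
    (hβ : s.β = ‖H s.x‖) (hε : 0 < s.ε) (h : s.ε ≤ p.α / (2 * p.μ) * ‖H s.x‖) :
    Invariant p H Ht s := by
  have h1 := hp.mul_le_of_le h
  have h2 := hp.error_le hε s.x
  have h3 := hp.α_mem
  have h0 := norm_pos_iff.2 hH
  refine ⟨hε, hβ ▸ h0, hβ ▸ h1, ?_, fun _ => ?_⟩
  · have h4 := norm_sub_norm_le (Ht s.x s.ε) (H s.x)
    rw [norm_sub_rev] at h4
    rw [hβ]; linarith
  · nlinarith [h3.1]

theorem invariant_initState (hp : p.Valid H Ht) {x₀ : EuclideanSpace ℝ (Fin n)} (h0 : H x₀ ≠ 0) :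
    Invariant p H Ht (initState p H x₀) := by
  refine .of_fresh hp h0 rfl ?_ le_rfl
  have := norm_pos_iff.2 h0
  have := hp.α_mem.1
  have := hp.μ_spec.1
  simp only [initState]
  positivity

theorem IsNextIterate.merit_le (hp : p.Valid H Ht) {s : State n} {x' : EuclideanSpace ℝ (Fin n)}
    (h : IsNextIterate p H Ht s x') :
    merit (fun y => Ht y s.ε) x' ≤ merit (fun y => Ht y s.ε) s.x := by
  obtain ⟨d, m, -, hm, rfl⟩ := h
  have h1 : LineSearchCond p H Ht s d m := hm.1
  unfold LineSearchCond at h1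
  have h2 : 0 ≤ p.σ * p.ρ ^ m * merit H s.x := by
    have := hp.σ_mem.1
    have := hp.ρ_mem.1
    unfold merit
    positivity
  linarith

/-- When the parameter is renewed, everything follows from its choice. When it is kept, the line
search does not increase the norm of the smoothed residual, and the failed test is itself the bound
on the relative smoothing error. At a zero of `H` the test need not have failed, hence the proviso
in `error_le`. -/
theorem Invariant.step (hp : p.Valid H Ht) {s s' : State n} (hs : Invariant p H Ht s)
    (h : Step p H Ht s s') : Invariant p H Ht s' := by
  obtain ⟨h0, hx, ⟨h0', -, hβ, hε, hle, -⟩ | ⟨htest, hβ, hε⟩⟩ := h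
  · exact .of_fresh hp h0' hβ hε (hle.trans (min_le_left _ _))
  · have h1 := hx.merit_le hp
    unfold merit at h1
    have h2 : ‖Ht s'.x s.ε‖ ≤ ‖Ht s.x s.ε‖ :=
      le_of_sq_le_sq (by linarith) (norm_nonneg _)
    refine ⟨hε ▸ hs.ε_pos, hβ ▸ hs.β_pos, by rw [hβ, hε]; exact hs.ε_le, ?_, fun h0' => ?_⟩
    · rw [hβ, hε]; exact h2.trans hs.norm_le
    · have h3 := htest.resolve_left h0'
      unfold DecreaseTest at h3
      have h4 := (max_lt_iff.1 (not_le.1 h3)).2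
      rw [inv_mul_lt_iff₀ hp.α_mem.1] at h4
      rw [hε]; exact h4.le

theorem Invariant.norm_residual_le (hp : p.Valid H Ht) {s : State n} (hs : Invariant p H Ht s) :
    ‖H s.x‖ ≤ (1 + p.α) * s.β := by
  have h1 := hp.error_le hs.ε_pos s.x
  have h2 := norm_sub_norm_le (H s.x) (Ht s.x s.ε)
  linarith [hs.norm_le, hs.ε_le]

/-- If every exponent failed, the difference quotients along `ρ ^ k` would pass to the limit and
bound the directional derivative from below, against descent. -/
theorem exists_lineSearchCond (h : IsRegularSmoothing H Ht c) (hp : p.Valid H Ht) {s : State n}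
    (hs : Invariant p H Ht s) (h0 : H s.x ≠ 0) {d : EuclideanSpace ℝ (Fin n)}
    (hd : IsNewtonDirection H Ht s d) : ∃ m, LineSearchCond p H Ht s d m := by
  by_contra! hcon
  have h1 := tendsto_slope_of_hasStrictFDerivAt (hasStrictFDerivAt_merit (h.contDiff _ hs.ε_pos) s.x)
    (u := fun _ => s.x) (v := fun _ => d) (t := fun k => p.ρ ^ k) tendsto_const_nhds
    tendsto_const_nhds (tendsto_pow_atTop_nhds_zero_of_lt_one hp.ρ_mem.1.le hp.ρ_mem.2)
    (Eventually.of_forall fun k => pow_pos hp.ρ_mem.1 k)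
  have h2 : -2 * p.σ * merit H s.x ≤
      ((innerSL ℝ (Ht s.x s.ε)).comp (fderiv ℝ (fun y => Ht y s.ε) s.x)) d := by
    refine ge_of_tendsto h1 (Eventually.of_forall fun k => ?_)
    have h3 := hcon k
    unfold LineSearchCond at h3
    rw [le_div_iff₀ (pow_pos hp.ρ_mem.1 k)]
    linarith
  have h4 := inner_lt_of_norm_sub_le hp.σ_mem.2 hp.α_mem.2 h0 (hs.error_le h0) hd
  simp only [ContinuousLinearMap.comp_apply, innerSL_apply_apply] at h2
  exact absurd h2 (not_le.2 h4)

theorem wellDefined (h : IsRegularSmoothing H Ht c) (hp : p.Valid H Ht)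
    (x₀ : EuclideanSpace ℝ (Fin n)) : WellDefined p H Ht x₀ := by
  intro s hs h0
  have hinv : Invariant p H Ht s := by
    -- If the initial guess is a zero, no step leaves it, so no nonterminated state is reachable.
    by_cases hx₀ : H x₀ = 0
    · rcases hs.cases_head with rfl | ⟨t, ht, -⟩
      · exact absurd hx₀ h0
      · exact absurd hx₀ ht.1
    · clear h0
      induction hs with
      | refl => exact invariant_initState hp hx₀
      | tail _ hstep ih => exact ih.step hp hstep
  refine ⟨hinv.ε_pos, (h.contDiff _ hinv.ε_pos).differentiable one_ne_zero _,
    h.existsUnique_isNewtonDirection hinv.ε_pos,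
    fun d hd => exists_lineSearchCond h hp hinv h0 hd, fun x' _ h0' _ => ?_⟩
  have h1 := norm_pos_iff.2 h0'
  have h2 := hp.α_mem.1
  have h3 := hp.μ_spec.1
  have h4 := hinv.ε_pos
  obtain ⟨e₀, he₀, he⟩ := h.consistent x' (p.γ * ‖H x'‖) (mul_pos hp.γ_pos h1)
  have h5 : 0 < min (p.α / (2 * p.μ) * ‖H x'‖) (s.ε / 2) := by positivity
  -- Halving `e₀` yields the strict inequality that consistency asks for.
  have h6 : 0 < min (min (p.α / (2 * p.μ) * ‖H x'‖) (s.ε / 2)) (e₀ / 2) := by positivity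
  exact ⟨_, h6, min_le_left _ _, he _ h6 ((min_le_right _ _).trans_lt (by linarith))⟩

end Steps

/-! ### Convergence of runs and the quadratic rate. -/

section Runs

variable {p : Params} {H : EuclideanSpace ℝ (Fin n) → EuclideanSpace ℝ (Fin n)}
  {Ht : EuclideanSpace ℝ (Fin n) → ℝ → EuclideanSpace ℝ (Fin n)} {c : ℝ}

/-- A state at which the smoothing parameter has just been adapted to the current iterate. -/
structure IsFresh (p : Params) (H : EuclideanSpace ℝ (Fin n) → EuclideanSpace ℝ (Fin n))
    (Ht : EuclideanSpace ℝ (Fin n) → ℝ → EuclideanSpace ℝ (Fin n)) (s : State n) : Prop where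
  β_eq : s.β = ‖H s.x‖
  ε_pos : 0 < s.ε
  ε_le : s.ε ≤ p.α / (2 * p.μ) * ‖H s.x‖
  infDist_le : Metric.infDist (fderiv ℝ (fun y => Ht y s.ε) s.x) (cSubdifferential H s.x) ≤
    p.γ * ‖H s.x‖

/-- The smoothing parameter is decreased in the step from `s` to `s'`. -/
def Decreases (p : Params) (H : EuclideanSpace ℝ (Fin n) → EuclideanSpace ℝ (Fin n))
    (Ht : EuclideanSpace ℝ (Fin n) → ℝ → EuclideanSpace ℝ (Fin n)) (s s' : State n) : Prop :=
  DecreaseTest p H Ht s s'.x ∧ s'.ε ≤ s.ε / 2 ∧ IsFresh p H Ht s'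

theorem Step.decreases_or {s s' : State n} (h : Step p H Ht s s') (h0 : H s'.x ≠ 0) :
    Decreases p H Ht s s' ∨ (¬ DecreaseTest p H Ht s s'.x ∧ s'.β = s.β ∧ s'.ε = s.ε) := by
  rcases h.2.2 with ⟨-, ht, hβ, hε, hle, hd⟩ | ⟨ht, hr⟩
  · exact .inl ⟨ht, hle.trans (min_le_right _ _), hβ, hε, hle.trans (min_le_left _ _), hd⟩
  · exact .inr ⟨ht.resolve_left h0, hr⟩

/-- The test passes for one of two reasons. The first gives the factor `η`; in the second, `μ * ε ≤
α / 2 * β` turns the smoothing error divided by `α` into at most `β / 2`. -/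
theorem Decreases.β_le (hp : p.Valid H Ht) {s s' : State n} (hs : Invariant p H Ht s)
    (h : Decreases p H Ht s s') : s'.β ≤ max p.η (1 / 2) * s.β := by
  rw [h.2.2.β_eq]
  have hβ := hs.β_pos
  rcases le_max_iff.1 h.1 with h1 | h1
  · exact h1.trans (by gcongr; exact le_max_left _ _)
  · have h2 := (hp.error_le hs.ε_pos s'.x).trans hs.ε_le
    have h3 : p.α⁻¹ * ‖H s'.x - Ht s'.x s.ε‖ ≤ 1 / 2 * s.β := by
      rw [inv_mul_le_iff₀ hp.α_mem.1]; linarith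
    exact h1.trans (h3.trans (by gcongr; exact le_max_right _ _))

/-- A run which does not terminate. -/
structure IsInfiniteRun (p : Params) (H : EuclideanSpace ℝ (Fin n) → EuclideanSpace ℝ (Fin n))
    (Ht : EuclideanSpace ℝ (Fin n) → ℝ → EuclideanSpace ℝ (Fin n)) (s : ℕ → State n) : Prop where
  step : ∀ k, Step p H Ht (s k) (s (k + 1))
  invariant : ∀ k, Invariant p H Ht (s k)

theorem IsInfiniteRun.β_antitone (hp : p.Valid H Ht) {s : ℕ → State n}
    (h : IsInfiniteRun p H Ht s) : Antitone (fun k => (s k).β) := by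
  refine antitone_nat_of_succ_le fun k => ?_
  rcases (h.step k).decreases_or (h.step (k + 1)).1 with h1 | h1
  · refine (h1.β_le hp (h.invariant k)).trans ?_
    have : max p.η (1 / 2) ≤ 1 := max_le hp.η_mem.2.le (by norm_num)
    nlinarith [(h.invariant k).β_pos]
  · exact h1.2.1.le

/-- Otherwise one fixed smoothed merit function decreases along the tail while `‖H‖` stays at least
`η * β`. The steps must shrink to zero, so the exponents just below the accepted ones, all rejected,
give at an accumulation point a slope too large for a Newton direction. -/
theorem IsInfiniteRun.frequently_decreases (hreg : IsRegularSmoothing H Ht c)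
    (hp : p.Valid H Ht) {xs : EuclideanSpace ℝ (Fin n)} (hxs : H xs = 0) {s : ℕ → State n}
    (h : IsInfiniteRun p H Ht s) : ∃ᶠ k in atTop, Decreases p H Ht (s k) (s (k + 1)) := by
  intro hcon
  obtain ⟨N, hN⟩ := eventually_atTop.1 hcon
  have hfail : ∀ k ≥ N, ¬ DecreaseTest p H Ht (s k) (s (k + 1)).x ∧
      (s (k + 1)).β = (s k).β ∧ (s (k + 1)).ε = (s k).ε := fun k hk =>
    ((h.step k).decreases_or (h.step (k + 1)).1).resolve_left (hN k hk)
  obtain ⟨β, hβ⟩ : ∃ β, β = (s N).β := ⟨_, rfl⟩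
  obtain ⟨ε, hε⟩ : ∃ ε, ε = (s N).ε := ⟨_, rfl⟩
  have hconst : ∀ j, (s (N + j)).β = β ∧ (s (N + j)).ε = ε := fun j => by
    induction j with
    | zero => exact ⟨hβ.symm, hε.symm⟩
    | succ j ih =>
      have := hfail (N + j) (by omega)
      exact ⟨this.2.1.trans ih.1, this.2.2.trans ih.2⟩
  have hβ0 : 0 < β := hβ ▸ (h.invariant N).β_pos
  have hε0 : 0 < ε := hε ▸ (h.invariant N).ε_pos
  have hη := hp.η_mem.1
  have hσ := hp.σ_mem.1
  have hρ := hp.ρ_mem.1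
  -- The tail starts at `N + 1`, since only iterates produced by a failed test are known to satisfy
  -- the lower bound on `‖H‖`.
  obtain ⟨x, hx⟩ : ∃ x : ℕ → EuclideanSpace ℝ (Fin n), ∀ j, x j = (s (N + 1 + j)).x :=
    ⟨_, fun _ => rfl⟩
  have hstate : ∀ j, (s (N + 1 + j)).ε = ε := fun j => by
    have := (hconst (1 + j)).2
    rwa [← add_assoc] at this
  have hstateβ : ∀ j, (s (N + 1 + j)).β = β := fun j => by
    have := (hconst (1 + j)).1
    rwa [← add_assoc] at this
  have hlow : ∀ j, p.η * β ≤ ‖H (x j)‖ := fun j => by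
    have h1 := (hfail (N + j) (by omega)).1
    unfold DecreaseTest at h1
    have h2 := (max_lt_iff.1 (not_le.1 h1)).1
    rw [(hconst j).1] at h2
    rw [hx, show N + 1 + j = N + j + 1 by omega]
    exact h2.le
  have hup : ∀ j, ‖H (x j)‖ ≤ (1 + p.α) * β := fun j => by
    have := (h.invariant (N + 1 + j)).norm_residual_le hp
    rwa [hstateβ, ← hx] at this
  have hstep : ∀ j, IsNextIterate p H Ht (s (N + 1 + j)) (x (j + 1)) := fun j => by
    rw [hx]; exact (h.step (N + 1 + j)).2.1
  choose d m hd hm hxd using hstep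
  have hH0 : ∀ j, H (x j) ≠ 0 := fun j =>
    norm_pos_iff.1 ((mul_pos hη hβ0).trans_le (hlow j))
  -- the step lengths tend to zero
  have hdec : ∀ j, p.σ * (p.η * β) ^ 2 * p.ρ ^ m j ≤
      merit (fun y => Ht y ε) (x j) - merit (fun y => Ht y ε) (x (j + 1)) := fun j => by
    have h1 : LineSearchCond p H Ht (s (N + 1 + j)) (d j) (m j) := (hm j).1
    unfold LineSearchCond at h1
    rw [← hxd, hstate, ← hx] at h1
    have h2 : (p.η * β) ^ 2 ≤ 2 * merit H (x j) := by
      have := hlow j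
      unfold merit
      have : (p.η * β) ^ 2 ≤ ‖H (x j)‖ ^ 2 := by gcongr
      linarith
    have h3 : p.σ * (p.η * β) ^ 2 * p.ρ ^ m j ≤ p.σ * (2 * merit H (x j)) * p.ρ ^ m j := by
      gcongr
    linarith
  have hlim : Tendsto (fun j => p.ρ ^ m j) atTop (𝓝 0) := by
    have hanti : Antitone (fun j => merit (fun y => Ht y ε) (x j)) :=
      antitone_nat_of_succ_le fun j => by
        have : 0 ≤ p.σ * (p.η * β) ^ 2 * p.ρ ^ m j := by positivity
        linarith [hdec j]
    have hbdd : BddBelow (Set.range (fun j => merit (fun y => Ht y ε) (x j))) := by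
      refine ⟨0, ?_⟩
      rintro _ ⟨j, rfl⟩
      simp only [merit]
      positivity
    -- A convergent sequence of merit values has vanishing successive differences, and these
    -- dominate the step lengths.
    have hT := tendsto_atTop_ciInf hanti hbdd
    have hT' := hT.sub (hT.comp (tendsto_add_atTop_nat 1))
    rw [sub_self] at hT'
    have hA : 0 < p.σ * (p.η * β) ^ 2 := by positivity
    have h1 := squeeze_zero (fun j => by positivity) hdec hT'
    have h2 := h1.const_mul (p.σ * (p.η * β) ^ 2)⁻¹
    rw [mul_zero] at h2
    refine h2.congr fun j => ?_
    rw [inv_mul_cancel_left₀ hA.ne']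
  -- the iterates and the directions accumulate
  have hbx : ∀ j, (x j, d j) ∈ Metric.closedBall xs ((1 + p.α) * β / c) ×ˢ
      Metric.closedBall (0 : EuclideanSpace ℝ (Fin n)) ((1 + p.α) * β / c) := fun j => by
    constructor
    · rw [Metric.mem_closedBall, dist_eq_norm, le_div_iff₀ hreg.c_pos]
      have := hreg.expand (x j) xs
      rw [hxs, sub_zero] at this
      linarith [hup j]
    · rw [mem_closedBall_zero_iff, le_div_iff₀ hreg.c_pos]
      have := hreg.norm_isNewtonDirection_le (h.invariant _).ε_pos (hd j)
      rw [← hx] at this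
      linarith [hup j]
  obtain ⟨⟨x', d'⟩, -, g, hg, hlimg⟩ := tendsto_subseq_of_bounded
    (Metric.isBounded_closedBall.prod Metric.isBounded_closedBall) hbx
  have hxg : Tendsto (fun k => x (g k)) atTop (𝓝 x') :=
    (continuous_fst.tendsto (x', d')).comp hlimg
  have hdg : Tendsto (fun k => d (g k)) atTop (𝓝 d') :=
    (continuous_snd.tendsto (x', d')).comp hlimg
  have hρg : Tendsto (fun k => p.ρ ^ m (g k)) atTop (𝓝 0) := hlim.comp hg.tendsto_atTop
  have hC := hreg.contDiff ε hε0
  have hHg : Tendsto (fun k => H (x (g k))) atTop (𝓝 (H x')) :=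
    (hreg.continuous.tendsto x').comp hxg
  have hHtg : Tendsto (fun k => Ht (x (g k)) ε) atTop (𝓝 (Ht x' ε)) :=
    (hC.continuous.tendsto x').comp hxg
  have hnewton : H x' + fderiv ℝ (fun y => Ht y ε) x' d' = 0 := by
    have hJ : Tendsto (fun k => fderiv ℝ (fun y => Ht y ε) (x (g k))) atTop
        (𝓝 (fderiv ℝ (fun y => Ht y ε) x')) :=
      ((hC.continuous_fderiv one_ne_zero).tendsto x').comp hxg
    have h1 : Tendsto (fun k => H (x (g k)) + fderiv ℝ (fun y => Ht y ε) (x (g k)) (d (g k))) atTop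
        (𝓝 (H x' + fderiv ℝ (fun y => Ht y ε) x' d')) :=
      hHg.add (tendsto_clm_apply hJ hdg)
    refine tendsto_nhds_unique h1 (tendsto_const_nhds.congr fun k => ?_)
    have := hd (g k)
    unfold IsNewtonDirection at this
    rw [hstate, ← hx] at this
    exact this.symm
  have herr : ‖H x' - Ht x' ε‖ ≤ p.α * ‖H x'‖ := by
    refine le_of_tendsto_of_tendsto' (hHg.sub hHtg).norm (hHg.norm.const_mul p.α) fun k => ?_
    have := (h.invariant (N + 1 + g k)).error_le (by rw [← hx]; exact hH0 _)
    rwa [hstate, ← hx] at this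
  have hx'0 : H x' ≠ 0 := norm_pos_iff.1
    ((mul_pos hη hβ0).trans_le (ge_of_tendsto' hHg.norm fun k => hlow _))
  have hlt := inner_lt_of_norm_sub_le hp.σ_mem.2 hp.α_mem.2 hx'0 herr hnewton
  -- The exponent zero would mean step length one, so eventually there is a rejected exponent `m -
  -- 1`.
  have hm1 : ∀ᶠ k in atTop, 1 ≤ m (g k) := by
    filter_upwards [hρg (Iio_mem_nhds one_pos)] with k hk
    simp only [Set.mem_preimage, Set.mem_Iio] at hk
    by_contra h0
    rw [Nat.lt_one_iff.1 (not_le.1 h0), pow_zero] at hk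
    exact lt_irrefl _ hk
  -- The step `ρ ^ m / ρ` is the last rejected one. Base points and directions both move, hence the
  -- use of strict differentiability.
  have hslope := tendsto_slope_of_hasStrictFDerivAt (hasStrictFDerivAt_merit hC x') hxg hdg
    (t := fun k => p.ρ ^ m (g k) / p.ρ) (by simpa using hρg.div_const p.ρ)
    (Eventually.of_forall fun k => by positivity)
  have hM : Tendsto (fun k => -2 * p.σ * merit H (x (g k))) atTop
      (𝓝 (-2 * p.σ * (1 / 2 * ‖H x'‖ ^ 2))) :=
    ((hHg.norm.pow 2).const_mul _).const_mul _
  have hge := le_of_tendsto_of_tendsto hM hslope (by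
    filter_upwards [hm1] with k hk
    have hpow : p.ρ ^ (m (g k) - 1) = p.ρ ^ m (g k) / p.ρ := by
      rw [eq_div_iff hρ.ne', ← pow_succ, Nat.sub_add_cancel hk]
    have h1 : ¬ LineSearchCond p H Ht (s (N + 1 + g k)) (d (g k)) (m (g k) - 1) := fun hls => by
      have := (hm (g k)).2 hls
      omega
    unfold LineSearchCond at h1
    rw [hstate, ← hx, hpow] at h1
    rw [le_div_iff₀ (by positivity)]
    linarith)
  simp only [ContinuousLinearMap.comp_apply, innerSL_apply_apply] at hge
  exact absurd hge (not_le.2 hlt)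

/-- The antitone sequence has a limit `l ≥ 0`, and the infinitely many contractions give `l ≤ q * l`
with `q < 1`. -/
theorem IsInfiniteRun.tendsto_β (hreg : IsRegularSmoothing H Ht c) (hp : p.Valid H Ht)
    {xs : EuclideanSpace ℝ (Fin n)} (hxs : H xs = 0) {s : ℕ → State n}
    (h : IsInfiniteRun p H Ht s) : Tendsto (fun k => (s k).β) atTop (𝓝 0) := by
  have hbdd : BddBelow (Set.range (fun k => (s k).β)) := by
    refine ⟨0, ?_⟩
    rintro _ ⟨k, rfl⟩
    exact (h.invariant k).β_pos.le
  have hT := tendsto_atTop_ciInf (h.β_antitone hp) hbdd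
  set l := ⨅ k, (s k).β
  have hl : 0 ≤ l := ge_of_tendsto' hT fun k => (h.invariant k).β_pos.le
  have hq : max p.η (1 / 2) < 1 := max_lt hp.η_mem.2 (by norm_num)
  have h1 : 0 ≤ max p.η (1 / 2) * l - l := by
    refine ge_of_tendsto_of_frequently
      ((hT.const_mul (max p.η (1 / 2))).sub (hT.comp (tendsto_add_atTop_nat 1)))
      ((h.frequently_decreases hreg hp hxs).mono fun k hk => ?_)
    have := hk.β_le hp (h.invariant k)
    simp only [Function.comp_apply]
    linarith
  have h2 : l = 0 := by nlinarith
  rwa [h2] at hT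

theorem IsInfiniteRun.tendsto_x (hreg : IsRegularSmoothing H Ht c) (hp : p.Valid H Ht)
    {xs : EuclideanSpace ℝ (Fin n)} (hxs : H xs = 0) {s : ℕ → State n}
    (h : IsInfiniteRun p H Ht s) : Tendsto (fun k => (s k).x) atTop (𝓝 xs) := by
  rw [tendsto_iff_norm_sub_tendsto_zero]
  have h1 := ((h.tendsto_β hreg hp hxs).const_mul (1 + p.α)).div_const c
  rw [mul_zero, zero_div] at h1
  refine squeeze_zero (fun _ => norm_nonneg _) (fun k => ?_) h1
  rw [le_div_iff₀ hreg.c_pos]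
  have h2 := hreg.expand (s k).x xs
  rw [hxs, sub_zero] at h2
  linarith [(h.invariant k).norm_residual_le hp]

/-- Near the solution, the full step from a fresh state is accepted, it decreases the residual, and
it converges quadratically. -/
theorem IsRegularSmoothing.exists_quadratic_step (hreg : IsRegularSmoothing H Ht c)
    (hp : p.Valid H Ht) {xs : EuclideanSpace ℝ (Fin n)} (hxs : H xs = 0) :
    ∃ r C : ℝ, 0 < r ∧ ∀ s : State n, IsFresh p H Ht s → H s.x ≠ 0 → ‖s.x - xs‖ < r →
      ∀ d, IsNewtonDirection H Ht s d → ‖s.x + d - xs‖ ≤ C * ‖s.x - xs‖ ^ 2 ∧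
        LineSearchCond p H Ht s d 0 ∧ ‖H (s.x + d)‖ ≤ p.η * ‖H s.x‖ := by
  obtain ⟨r, K, hr, hK, hsemi⟩ := hreg.semismooth xs
  have hc := hreg.c_pos
  have hγ := hp.γ_pos
  have hη := hp.η_mem.1
  obtain ⟨hα0, hα1⟩ := hp.α_mem
  have hσ := hp.σ_mem.2
  obtain ⟨C, hC⟩ : ∃ C, C = (2 * p.γ * K + K) / c := ⟨_, rfl⟩
  have hC0 : 0 < C := by rw [hC]; positivity
  -- a relative decrease of the residual that is sufficient for the line search
  obtain ⟨τ, hτ0, hτη, hτ⟩ : ∃ τ, 0 < τ ∧ τ ≤ p.η ∧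
      (p.α / 2 + τ) ^ 2 + 2 * p.σ ≤ (1 - p.α / 2) ^ 2 := by
    have h1 : ∀ᶠ τ in 𝓝[>] (0 : ℝ), (p.α / 2 + τ) ^ 2 + 2 * p.σ < (1 - p.α / 2) ^ 2 := by
      have : ContinuousAt (fun τ : ℝ => (p.α / 2 + τ) ^ 2 + 2 * p.σ) 0 := by fun_prop
      exact (this.eventually_lt_const (by nlinarith)).filter_mono nhdsWithin_le_nhds
    obtain ⟨τ, h2, h3⟩ := (h1.and (Ioo_mem_nhdsGT hη)).exists
    exact ⟨τ, h3.1, h3.2.le, h2.le⟩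
  -- The bounds `r / C` and `1` keep the new point within the radius `r`; the last bound turns its
  -- quadratic error into the residual factor `τ`.
  refine ⟨min (min r (r / C)) (min 1 (τ * c / (K * C))), C, by positivity, ?_⟩
  intro s hs h0 hsr d hd
  simp only [lt_min_iff] at hsr
  obtain ⟨⟨hr1, hr2⟩, hr3, hr4⟩ := hsr
  obtain ⟨e, he⟩ : ∃ e, e = ‖s.x - xs‖ := ⟨_, rfl⟩
  have he0 : 0 ≤ e := he ▸ norm_nonneg _
  rw [← he] at hr1 hr2 hr3 hr4
  rw [← he]
  have hH0 := norm_pos_iff.2 h0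
  obtain ⟨hlip, hV⟩ := hsemi s.x (he ▸ hr1)
  rw [hxs, sub_zero, ← he] at hlip
  rw [hxs, sub_zero, ← he] at hV
  set J := fderiv ℝ (fun y => Ht y s.ε) s.x with hJ
  have hexp := hreg.expand s.x xs
  rw [hxs, sub_zero, ← he] at hexp
  -- Doubling `γ` makes the inequality strict, so a nearby element exists without the distance
  -- having to be attained.
  obtain ⟨V, hVmem, hVd⟩ := (Metric.infDist_lt_iff (hreg.nonempty s.x)).1
    (hs.infDist_le.trans_lt (show p.γ * ‖H s.x‖ < 2 * p.γ * ‖H s.x‖ by nlinarith))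
  rw [dist_eq_norm] at hVd
  have hquad : ‖s.x + d - xs‖ ≤ C * e ^ 2 := by
    -- The Newton equation splits the new error into a Jacobian mismatch and a linearization error
    -- of `V`, both quadratic in `e`.
    have h1 : J (s.x + d - xs) = (J - V) (s.x - xs) + (V (s.x - xs) - H s.x) := by
      have h2 : H s.x = -J d := by
        unfold IsNewtonDirection at hd
        exact eq_neg_of_add_eq_zero_left hd
      rw [h2, sub_apply, show s.x + d - xs = (s.x - xs) + d by abel, map_add]
      abel
    have h3 := hreg.expand_fderiv s.ε hs.ε_pos s.x (s.x + d - xs)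
    rw [← hJ, h1] at h3
    have h4 : ‖(J - V) (s.x - xs)‖ ≤ 2 * p.γ * (K * e) * e :=
      ((J - V).le_opNorm _).trans (by rw [← he]; gcongr; exact hVd.le.trans (by gcongr))
    have h5 := norm_add_le ((J - V) (s.x - xs)) (V (s.x - xs) - H s.x)
    have h6 := hV V hVmem
    rw [hC, div_mul_eq_mul_div, le_div_iff₀ hc]
    linarith
  have hCe : C * e ^ 2 < r := by
    have : C * e < r := by rwa [lt_div_iff₀ hC0, mul_comm] at hr2
    nlinarith
  have hres : ‖H (s.x + d)‖ ≤ τ * ‖H s.x‖ := by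
    have h1 := (hsemi (s.x + d) (hquad.trans_lt hCe)).1
    rw [hxs, sub_zero] at h1
    have h2 : K * C * e ≤ τ * c := by
      rw [lt_div_iff₀ (by positivity)] at hr4; linarith
    calc ‖H (s.x + d)‖ ≤ K * (C * e ^ 2) := h1.trans (by gcongr)
      _ = (K * C * e) * e := by ring
      _ ≤ (τ * c) * e := by gcongr
      _ = τ * (c * e) := by ring
      _ ≤ τ * ‖H s.x‖ := by gcongr
  refine ⟨hquad, ?_, hres.trans (by gcongr)⟩
  have hε := hp.mul_le_of_le hs.ε_le
  have h1 : ‖Ht (s.x + d) s.ε‖ ≤ (p.α / 2 + τ) * ‖H s.x‖ := by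
    have h2 := hp.error_le hs.ε_pos (s.x + d)
    have h3 := norm_sub_norm_le (Ht (s.x + d) s.ε) (H (s.x + d))
    rw [norm_sub_rev] at h3
    linarith
  have h2 : (1 - p.α / 2) * ‖H s.x‖ ≤ ‖Ht s.x s.ε‖ := by
    have h3 := hp.error_le hs.ε_pos s.x
    have h4 := norm_sub_norm_le (H s.x) (Ht s.x s.ε)
    linarith
  have h3 : ‖Ht (s.x + d) s.ε‖ ^ 2 ≤ ((p.α / 2 + τ) * ‖H s.x‖) ^ 2 := by gcongr
  have h4 : ((1 - p.α / 2) * ‖H s.x‖) ^ 2 ≤ ‖Ht s.x s.ε‖ ^ 2 := by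
    have : 0 ≤ (1 - p.α / 2) * ‖H s.x‖ := mul_nonneg (by linarith) hH0.le
    gcongr
  have h5 := mul_le_mul_of_nonneg_right hτ (sq_nonneg ‖H s.x‖)
  simp only [LineSearchCond, merit, pow_zero, one_smul]
  linarith

theorem IsInfiniteRun.eventually_quadratic (hreg : IsRegularSmoothing H Ht c) (hp : p.Valid H Ht)
    {xs : EuclideanSpace ℝ (Fin n)} (hxs : H xs = 0) {s : ℕ → State n}
    (h : IsInfiniteRun p H Ht s) :
    ∃ C : ℝ, ∀ᶠ k in atTop, ‖(s (k + 1)).x - xs‖ ≤ C * ‖(s k).x - xs‖ ^ 2 := by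
  obtain ⟨r, C, hr, hq⟩ := hreg.exists_quadratic_step hp hxs
  have h1 := tendsto_iff_norm_sub_tendsto_zero.1 (h.tendsto_x hreg hp hxs)
  obtain ⟨N, hN⟩ := eventually_atTop.1 (h1 (Iio_mem_nhds hr))
  simp only [Set.mem_Iio] at hN
  obtain ⟨k₀, hk₀, hdec⟩ := frequently_atTop.1 (h.frequently_decreases hreg hp hxs) N
  -- At a fresh state `β` equals `‖H x‖`, so the residual reduction by `η` passes the decrease test
  -- and the next state is fresh too.
  have key : ∀ k ≥ N, IsFresh p H Ht (s k) →
      IsFresh p H Ht (s (k + 1)) ∧ ‖(s (k + 1)).x - xs‖ ≤ C * ‖(s k).x - xs‖ ^ 2 := by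
    intro k hk hf
    obtain ⟨d, m, hd, hm, hx⟩ := (h.step k).2.1
    obtain ⟨hquad, hls, hres⟩ := hq (s k) hf (h.step k).1 (hN k hk) d hd
    have hm0 : m = 0 := Nat.le_zero.1 (hm.2 hls)
    rw [hm0, pow_zero, one_smul] at hx
    rw [← hx] at hquad hres
    refine ⟨?_, hquad⟩
    rcases (h.step k).decreases_or (h.step (k + 1)).1 with h2 | h2
    · exact h2.2.2
    · refine absurd (le_max_of_le_left ?_) h2.1
      rwa [hf.β_eq]
  have hfresh : ∀ j, IsFresh p H Ht (s (k₀ + 1 + j)) := fun j => by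
    induction j with
    | zero => exact hdec.2.2
    | succ j ih => exact (key _ (by omega) ih).1
  refine ⟨C, eventually_atTop.2 ⟨k₀ + 1, fun k hk => ?_⟩⟩
  obtain ⟨j, rfl⟩ := Nat.exists_eq_add_of_le hk
  exact (key _ (by omega) (hfresh j)).2

theorem IsRun.convergence (hreg : IsRegularSmoothing H Ht c) (hp : p.Valid H Ht)
    {xs x₀ : EuclideanSpace ℝ (Fin n)} (hxs : H xs = 0) {s : ℕ → State n}
    (h : IsRun p H Ht x₀ s) : Tendsto (fun k => (s k).x) atTop (𝓝 xs) ∧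
      ∃ C : ℝ, ∀ᶠ k in atTop, ‖(s (k + 1)).x - xs‖ ≤ C * ‖(s k).x - xs‖ ^ 2 := by
  by_cases hterm : ∃ N, H (s N).x = 0
  · obtain ⟨N, hN⟩ := hterm
    have hconst : ∀ j, s (N + j) = s N := fun j => by
      induction j with
      | zero => rfl
      | succ j ih =>
        rcases h.2 (N + j) with h1 | h1
        · exact absurd (ih ▸ hN) h1.1
        · exact h1.2.trans ih
    have hx : ∀ k ≥ N, (s k).x = xs := fun k hk => by
      obtain ⟨j, rfl⟩ := Nat.exists_eq_add_of_le hk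
      rw [hconst]
      exact hreg.eq_of_zero hxs hN
    refine ⟨tendsto_const_nhds.congr' ?_, 0, ?_⟩
    · filter_upwards [eventually_ge_atTop N] with k hk using (hx k hk).symm
    · filter_upwards [eventually_ge_atTop N] with k hk
      rw [hx (k + 1) (by omega), sub_self, norm_zero, zero_mul]
  · push Not at hterm
    have hstep : ∀ k, Step p H Ht (s k) (s (k + 1)) := fun k =>
      (h.2 k).resolve_right fun h1 => hterm k h1.1
    have hinf : IsInfiniteRun p H Ht s := by
      refine ⟨hstep, fun k => ?_⟩
      induction k with
      | zero =>
        have h1 := hterm 0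
        rw [h.1] at h1 ⊢
        exact invariant_initState hp h1
      | succ k ih => exact ih.step hp (hstep k)
    exact ⟨hinf.tendsto_x hreg hp hxs, hinf.eventually_quadratic hreg hp hxs⟩

end Runs

/-! ### Piecewise `C²` functions of one variable and their smoothings. -/

section Scalar

theorem exists_slope_of_contDiffOn_Icc {φ : ℝ → ℝ} {a b : ℝ} (hab : a < b)
    (h : ContDiffOn ℝ 2 φ (Set.Icc a b)) :
    ∃ (g : ℝ → ℝ) (K : ℝ), 0 < K ∧ ContinuousOn g (Set.Icc a b) ∧
      (∀ s ∈ Set.Ioo a b, HasDerivAt φ (g s) s) ∧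
      (∀ s ∈ Set.Icc a b, DifferentiableAt ℝ φ s → deriv φ s = g s) ∧
      (∀ s ∈ Set.Icc a b, ∀ t ∈ Set.Icc a b, |φ t - φ s| ≤ K * |t - s|) ∧
      (∀ s ∈ Set.Icc a b, ∀ t ∈ Set.Icc a b, |φ t - φ s - g s * (t - s)| ≤ K * |t - s| ^ 2) := by
  have hu : UniqueDiffOn ℝ (Set.Icc a b) := uniqueDiffOn_Icc hab
  set g := derivWithin φ (Set.Icc a b) with hg
  have hg1 : ContDiffOn ℝ 1 g (Set.Icc a b) := h.derivWithin hu (by norm_num)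
  have hd : ∀ s ∈ Set.Icc a b, HasDerivWithinAt φ (g s) (Set.Icc a b) s := fun s hs =>
    (h.differentiableOn (by norm_num) s hs).hasDerivWithinAt
  obtain ⟨K₁, hK₁⟩ := h.exists_lipschitzOnWith (by norm_num) (convex_Icc a b) isCompact_Icc
  obtain ⟨K₂, hK₂⟩ := hg1.exists_lipschitzOnWith (by norm_num) (convex_Icc a b) isCompact_Icc
  refine ⟨g, K₁ + K₂ + 1, by positivity, hg1.continuousOn, fun s hs => ?_, fun s hs hs' => ?_,
    fun s hs t ht => ?_, fun s hs t ht => ?_⟩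
  · exact (hd s (Set.Ioo_subset_Icc_self hs)).hasDerivAt (Icc_mem_nhds hs.1 hs.2)
  · exact (hs'.derivWithin (hu s hs)).symm
  · have h1 := hK₁.dist_le_mul t ht s hs
    rw [Real.dist_eq, Real.dist_eq] at h1
    nlinarith [abs_nonneg (t - s), K₂.2]
  · have hsub : Set.uIcc s t ⊆ Set.Icc a b := Set.ordConnected_Icc.uIcc_subset hs ht
    -- The mean value inequality is applied to `φ` minus its linear part at `s`, whose derivative is
    -- controlled by the Lipschitz constant of `g`.
    have h2 : ∀ r ∈ Set.uIcc s t, HasDerivWithinAt (fun r => φ r - g s * r) (g r - g s)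
        (Set.uIcc s t) r := fun r hr => by
      simpa using ((hd r (hsub hr)).mono hsub).fun_sub
        ((hasDerivWithinAt_id r (Set.uIcc s t)).const_mul (g s))
    have h3 := (convex_uIcc s t).norm_image_sub_le_of_norm_hasDerivWithin_le
      (C := K₂ * |t - s|) h2 (fun r hr => by
        have h4 := hK₂.dist_le_mul r (hsub hr) s hs
        rw [Real.dist_eq, Real.dist_eq] at h4
        have h5 : |r - s| ≤ |t - s| := Set.abs_sub_left_of_mem_uIcc hr
        rw [Real.norm_eq_abs]
        exact h4.trans (by gcongr)) Set.left_mem_uIcc Set.right_mem_uIcc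
    rw [Real.norm_eq_abs, Real.norm_eq_abs] at h3
    have h6 : φ t - φ s - g s * (t - s) = φ t - g s * t - (φ s - g s * s) := by ring
    rw [h6]
    nlinarith [sq_nonneg (|t - s|), K₁.2]

/-- The local structure of a piecewise `C²` function at `t`: the one-sided slopes `pL`, `pR`, and
a radius `r` and a constant `K` for the first and second order estimates. -/
structure HasLocalSlopes (φ : ℝ → ℝ) (t r K pL pR : ℝ) : Prop where
  r_pos : 0 < r
  K_pos : 0 < K
  tendsto_left : Tendsto (deriv φ) (𝓝[<] t) (𝓝 pL)
  tendsto_right : Tendsto (deriv φ) (𝓝[>] t) (𝓝 pR)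
  deriv_eq : DifferentiableAt ℝ φ t → deriv φ t = pL ∧ deriv φ t = pR
  differentiableAt : ∀ s, |s - t| < r → s ≠ t → DifferentiableAt ℝ φ s
  continuousAt : ∀ s, |s - t| < r → s ≠ t → ContinuousAt (deriv φ) s
  lipschitz : ∀ s, |s - t| < r → |φ s - φ t| ≤ K * |s - t|
  taylor : ∀ s, |s - t| < r → s ≠ t → |deriv φ s * (s - t) - (φ s - φ t)| ≤ K * |s - t| ^ 2

theorem PiecewiseContDiff.exists_hasLocalSlopes {φ : ℝ → ℝ} (h : PiecewiseContDiff 2 φ) (t : ℝ) :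
    ∃ r K pL pR, HasLocalSlopes φ t r K pL pR := by
  obtain ⟨-, S, hS⟩ := h
  -- In a small enough neighbourhood only `t` itself can be a breakpoint, so `φ` is `C²` on a closed
  -- interval on each side.
  have h1 : ∀ᶠ s in 𝓝 t, s ∉ S.erase t := by
    have : IsClosed (↑(S.erase t) : Set ℝ) := (S.erase t).finite_toSet.isClosed
    exact this.isOpen_compl.mem_nhds (by simp)
  obtain ⟨r, hr, hball⟩ := Metric.eventually_nhds_iff.1 h1
  have hR : ContDiffOn ℝ 2 φ (Set.Icc t (t + r)) := hS _ _ (by linarith) fun s hs hst =>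
    hball (y := s) (by rw [Real.dist_eq, abs_lt]; constructor <;> linarith [hst.1, hst.2])
      (Finset.mem_erase.2 ⟨hst.1.ne', hs⟩)
  have hL : ContDiffOn ℝ 2 φ (Set.Icc (t - r) t) := hS _ _ (by linarith) fun s hs hst =>
    hball (y := s) (by rw [Real.dist_eq, abs_lt]; constructor <;> linarith [hst.1, hst.2])
      (Finset.mem_erase.2 ⟨hst.2.ne, hs⟩)
  have htr : t < t + r := by linarith
  have htl : t - r < t := by linarith
  obtain ⟨gR, KR, hKR, hcR, hdR, heR, hlR, htR⟩ := exists_slope_of_contDiffOn_Icc htr hR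
  obtain ⟨gL, KL, hKL, hcL, hdL, heL, hlL, htL⟩ := exists_slope_of_contDiffOn_Icc htl hL
  have hmR : t ∈ Set.Icc t (t + r) := Set.left_mem_Icc.2 htr.le
  have hmL : t ∈ Set.Icc (t - r) t := Set.right_mem_Icc.2 htl.le
  have key : ∀ s, |s - t| < r → s ≠ t → s ∈ Set.Ioo (t - r) t ∨ s ∈ Set.Ioo t (t + r) := by
    intro s hs hne
    rw [abs_lt] at hs
    rcases lt_or_gt_of_ne hne with h | h
    · exact .inl ⟨by linarith, h⟩
    · exact .inr ⟨h, by linarith⟩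
  refine ⟨r, KL + KR, gL t, gR t, hr, by positivity, ?_, ?_, fun ht => ⟨heL t hmL ht, heR t hmR ht⟩,
    fun s hs hne => ?_, fun s hs hne => ?_, fun s hs => ?_, fun s hs hne => ?_⟩
  · have h2 : Tendsto gL (𝓝[Set.Ioo (t - r) t] t) (𝓝 (gL t)) :=
      (hcL t hmL).mono_left (nhdsWithin_mono _ Set.Ioo_subset_Icc_self)
    rw [nhdsWithin_Ioo_eq_nhdsLT htl] at h2
    refine h2.congr' ?_
    filter_upwards [Ioo_mem_nhdsLT htl] with s hs using (hdL s hs).deriv.symm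
  · have h2 : Tendsto gR (𝓝[Set.Ioo t (t + r)] t) (𝓝 (gR t)) :=
      (hcR t hmR).mono_left (nhdsWithin_mono _ Set.Ioo_subset_Icc_self)
    rw [nhdsWithin_Ioo_eq_nhdsGT htr] at h2
    refine h2.congr' ?_
    filter_upwards [Ioo_mem_nhdsGT htr] with s hs using (hdR s hs).deriv.symm
  · rcases key s hs hne with h | h
    · exact (hdL s h).differentiableAt
    · exact (hdR s h).differentiableAt
  · rcases key s hs hne with h | h
    · refine (hcL.continuousAt (Icc_mem_nhds h.1 h.2)).congr ?_
      filter_upwards [Ioo_mem_nhds h.1 h.2] with u hu using (hdL u hu).deriv.symm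
    · refine (hcR.continuousAt (Icc_mem_nhds h.1 h.2)).congr ?_
      filter_upwards [Ioo_mem_nhds h.1 h.2] with u hu using (hdR u hu).deriv.symm
  · rcases eq_or_ne s t with rfl | hne
    · simp
    rcases key s hs hne with h | h
    · have := hlL t hmL s (Set.Ioo_subset_Icc_self h)
      nlinarith [abs_nonneg (s - t)]
    · have := hlR t hmR s (Set.Ioo_subset_Icc_self h)
      nlinarith [abs_nonneg (s - t)]
  · have e : ∀ g : ℝ, φ t - φ s - g * (t - s) = g * (s - t) - (φ s - φ t) := fun g => by ring
    rcases key s hs hne with h | h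
    -- The expansion is based at the nearby point `s` and evaluated at `t`, because the derivative
    -- entering the Newton step is the one at `s`.
    · have := htL s (Set.Ioo_subset_Icc_self h) t hmL
      rw [e, abs_sub_comm t s] at this
      rw [(hdL s h).deriv]
      nlinarith [sq_nonneg |s - t|]
    · have := htR s (Set.Ioo_subset_Icc_self h) t hmR
      rw [e, abs_sub_comm t s] at this
      rw [(hdR s h).deriv]
      nlinarith [sq_nonneg |s - t|]

/-- The slopes of an admissible smoothing approach the interval of one-sided slopes. -/
theorem HasLocalSlopes.eventually_deriv_near {φ : ℝ → ℝ} {ψ : ℝ → ℝ → ℝ} {t r K pL pR : ℝ}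
    (h : HasLocalSlopes φ t r K pL pR) (hψ : IsAdmissible φ ψ) {η : ℝ} (hη : 0 < η) :
    ∀ᶠ ε in 𝓝[>] (0 : ℝ), ∃ w ∈ segment ℝ pL pR, |deriv (fun s => ψ s ε) t - w| ≤ η := by
  obtain ⟨ε₀, hε₀, δ₁, δ₂, hδ₁, hδ₂, hco⟩ := hψ.slope t
  obtain ⟨r₁, hr₁, hL⟩ := Metric.mem_nhdsWithin_iff.1
    (h.tendsto_left (Metric.closedBall_mem_nhds pL hη))
  obtain ⟨r₂, hr₂, hR⟩ := Metric.mem_nhdsWithin_iff.1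
    (h.tendsto_right (Metric.closedBall_mem_nhds pR hη))
  filter_upwards [Ioo_mem_nhdsGT hε₀, hδ₁ (Iio_mem_nhds hr₁), hδ₂ (Iio_mem_nhds hr₂)]
    with ε hε h₁ h₂
  simp only [Set.mem_preimage, Set.mem_Iio] at h₁ h₂
  obtain ⟨h₁', h₂', hd₁, hd₂, hmem⟩ := hco ε hε.1 hε.2
  have hu : |deriv φ (t - δ₁ ε) - pL| ≤ η := by
    -- A zero shift is allowed; then `φ` is differentiable at `t`, and both one-sided slopes equal
    -- its derivative.
    rcases h₁'.eq_or_lt with h0 | h0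
    · rw [← h0, sub_zero] at hd₁ ⊢
      rw [(h.deriv_eq hd₁).1, sub_self, abs_zero]
      exact hη.le
    · have := hL (a := t - δ₁ ε) ⟨by
        rw [Metric.mem_ball, Real.dist_eq, sub_sub_cancel_left, abs_neg, abs_of_pos h0]
        exact h₁, by simpa using h0⟩
      simpa [Real.dist_eq] using this
  have hv : |deriv φ (t + δ₂ ε) - pR| ≤ η := by
    rcases h₂'.eq_or_lt with h0 | h0
    · rw [← h0, add_zero] at hd₂ ⊢
      rw [(h.deriv_eq hd₂).2, sub_self, abs_zero]
      exact hη.le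
    · have := hR (a := t + δ₂ ε) ⟨by
        rw [Metric.mem_ball, Real.dist_eq, add_sub_cancel_left, abs_of_pos h0]
        exact h₂, by simpa using h0⟩
      simpa [Real.dist_eq] using this
  rw [convexHull_pair] at hmem
  obtain ⟨a, b, ha, hb, hab, he⟩ := hmem
  refine ⟨a • pL + b • pR, ⟨a, b, ha, hb, hab, rfl⟩, ?_⟩
  rw [← he]
  simp only [smul_eq_mul]
  have e : a * deriv φ (t - δ₁ ε) + b * deriv φ (t + δ₂ ε) - (a * pL + b * pR) =
      a * (deriv φ (t - δ₁ ε) - pL) + b * (deriv φ (t + δ₂ ε) - pR) := by ring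
  rw [e]
  calc |a * (deriv φ (t - δ₁ ε) - pL) + b * (deriv φ (t + δ₂ ε) - pR)|
      ≤ a * |deriv φ (t - δ₁ ε) - pL| + b * |deriv φ (t + δ₂ ε) - pR| := by
        refine (abs_add_le _ _).trans_eq ?_
        rw [abs_mul, abs_mul, abs_of_nonneg ha, abs_of_nonneg hb]
    _ ≤ a * η + b * η := by gcongr
    _ = η := by rw [← add_mul, hab, one_mul]

end Scalar

/-! ### Coercivity of `A`. -/

theorem norm_le_sum_abs (v : EuclideanSpace ℝ (Fin n)) : ‖v‖ ≤ ∑ i, |v i| := by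
  have h0 : 0 ≤ ∑ i, |v i| := Finset.sum_nonneg fun i _ => abs_nonneg _
  refine le_of_sq_le_sq ?_ h0
  rw [EuclideanSpace.norm_sq_eq]
  exact Finset.sum_sq_le_sq_sum_of_nonneg fun i _ => abs_nonneg (v i)

theorem exists_coercive {A : Matrix (Fin n) (Fin n) ℝ} (hA : A.PosDef) :
    ∃ c : ℝ, 0 < c ∧ ∀ x : EuclideanSpace ℝ (Fin n),
      c * ‖x‖ ^ 2 ≤ inner ℝ x (Matrix.toEuclideanCLM (𝕜 := ℝ) A x) := by
  obtain ⟨L, hL⟩ : ∃ L, L = Matrix.toEuclideanCLM (𝕜 := ℝ) A := ⟨_, rfl⟩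
  rw [← hL]
  have hpos : ∀ x : EuclideanSpace ℝ (Fin n), x ≠ 0 → 0 < inner ℝ x (L x) := fun x hx => by
    rw [hL, Matrix.inner_toEuclideanCLM]
    have := hA.dotProduct_mulVec_pos (x := WithLp.ofLp x) (by simpa using hx)
    simpa using this
  -- The unit sphere is empty in dimension zero. Otherwise the minimum of the quadratic form on it
  -- is the constant, by homogeneity.
  rcases (Metric.sphere (0 : EuclideanSpace ℝ (Fin n)) 1).eq_empty_or_nonempty with he | hne
  · refine ⟨1, one_pos, fun x => ?_⟩
    rcases eq_or_ne x 0 with rfl | hx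
    · simp
    · have : ‖x‖⁻¹ • x ∈ Metric.sphere (0 : EuclideanSpace ℝ (Fin n)) 1 := by
        simp [norm_smul, hx]
      rw [he] at this
      exact this.elim
  · obtain ⟨u, hu, hmin⟩ := (isCompact_sphere (0 : EuclideanSpace ℝ (Fin n)) 1).exists_isMinOn hne
      (f := fun x => inner ℝ x (L x)) (by fun_prop)
    have hu0 : u ≠ 0 := fun h => by simp [h] at hu
    refine ⟨_, hpos u hu0, fun x => ?_⟩
    rcases eq_or_ne x 0 with rfl | hx
    · simp
    · have hx' := norm_pos_iff.2 hx
      have h1 := hmin (a := ‖x‖⁻¹ • x) (by simp [norm_smul, hx])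
      simp only [Set.mem_ofPred_eq, map_smul, inner_smul_left, inner_smul_right] at h1
      have h2 := mul_le_mul_of_nonneg_right h1 (sq_nonneg ‖x‖)
      refine h2.trans_eq ?_
      simp
      field_simp

/-! ### The Jacobian `A + diag w` -/

/-- The linear map `A + diag w`. -/
def jac (A : Matrix (Fin n) (Fin n) ℝ) (w : Fin n → ℝ) :
    EuclideanSpace ℝ (Fin n) →L[ℝ] EuclideanSpace ℝ (Fin n) :=
  Matrix.toEuclideanCLM (𝕜 := ℝ) A + Matrix.toEuclideanCLM (𝕜 := ℝ) (Matrix.diagonal w)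

/-- The `i`-th row of `A`, with `w` added to its diagonal entry. -/
def rowMap (A : Matrix (Fin n) (Fin n) ℝ) (i : Fin n) (w : ℝ) :
    EuclideanSpace ℝ (Fin n) →L[ℝ] ℝ :=
  (EuclideanSpace.proj i).comp (Matrix.toEuclideanCLM (𝕜 := ℝ) A) + w • EuclideanSpace.proj i

theorem jac_apply (A : Matrix (Fin n) (Fin n) ℝ) (w : Fin n → ℝ)
    (d : EuclideanSpace ℝ (Fin n)) (i : Fin n) :
    jac A w d i = Matrix.toEuclideanCLM (𝕜 := ℝ) A d i + w i * d i := by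
  simp [jac, Matrix.ofLp_toEuclideanCLM, Matrix.mulVec_diagonal]

theorem rowMap_apply (A : Matrix (Fin n) (Fin n) ℝ) (i : Fin n) (w : ℝ)
    (d : EuclideanSpace ℝ (Fin n)) :
    rowMap A i w d = Matrix.toEuclideanCLM (𝕜 := ℝ) A d i + w * d i := by
  simp [rowMap]

theorem proj_comp_jac (A : Matrix (Fin n) (Fin n) ℝ) (w : Fin n → ℝ) (i : Fin n) :
    (EuclideanSpace.proj i : EuclideanSpace ℝ (Fin n) →L[ℝ] ℝ).comp (jac A w) =
      rowMap A i (w i) := by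
  ext d
  simp [rowMap_apply, jac_apply]

theorem residual_apply (A : Matrix (Fin n) (Fin n) ℝ) (g : Fin n → ℝ → ℝ)
    (f x : EuclideanSpace ℝ (Fin n)) (i : Fin n) :
    residual A g f x i = Matrix.toEuclideanCLM (𝕜 := ℝ) A x i + g i (x i) - f i := by
  simp [residual]

theorem norm_jac_sub_le (A : Matrix (Fin n) (Fin n) ℝ) (w v : Fin n → ℝ) :
    ‖jac A w - jac A v‖ ≤ ∑ i, |w i - v i| := by
  refine ContinuousLinearMap.opNorm_le_bound _
    (Finset.sum_nonneg fun i _ => abs_nonneg _) fun d => (norm_le_sum_abs _).trans ?_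
  rw [Finset.sum_mul]
  refine Finset.sum_le_sum fun i _ => ?_
  have h1 : (jac A w - jac A v) d i = (w i - v i) * d i := by
    rw [sub_apply, PiLp.sub_apply, jac_apply, jac_apply]; ring
  rw [h1, abs_mul]
  gcongr
  exact PiLp.norm_apply_le d i

theorem le_norm_of_coercive {E : Type*} [NormedAddCommGroup E] [InnerProductSpace ℝ E] {c : ℝ}
    {x y : E} (h : c * ‖x‖ ^ 2 ≤ inner ℝ x y) : c * ‖x‖ ≤ ‖y‖ := by
  rcases (norm_nonneg x).eq_or_lt with h0 | h0
  · rw [← h0, mul_zero]; exact norm_nonneg _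
  · have h1 := h.trans (real_inner_le_norm x y)
    have h2 : ‖x‖ * (c * ‖x‖) ≤ ‖x‖ * ‖y‖ := by linarith
    exact le_of_mul_le_mul_left h2 h0

theorem norm_le_jac {A : Matrix (Fin n) (Fin n) ℝ} {c : ℝ}
    (hc : ∀ x : EuclideanSpace ℝ (Fin n),
      c * ‖x‖ ^ 2 ≤ inner ℝ x (Matrix.toEuclideanCLM (𝕜 := ℝ) A x)) {w : Fin n → ℝ}
    (hw : ∀ i, 0 ≤ w i) (d : EuclideanSpace ℝ (Fin n)) : c * ‖d‖ ≤ ‖jac A w d‖ := by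
  refine le_norm_of_coercive ((hc d).trans ?_)
  rw [PiLp.inner_apply, PiLp.inner_apply]
  refine Finset.sum_le_sum fun i _ => ?_
  rw [jac_apply]
  simp only [RCLike.inner_apply, conj_trivial]
  nlinarith [mul_nonneg (hw i) (mul_self_nonneg (d i))]

/-- Monotonicity makes the diagonal part contribute a nonnegative amount to the inner product with
`x - y`, so the coercivity of `A` survives. -/
theorem norm_sub_le_residual {A : Matrix (Fin n) (Fin n) ℝ} {c : ℝ}
    (hc : ∀ x : EuclideanSpace ℝ (Fin n),
      c * ‖x‖ ^ 2 ≤ inner ℝ x (Matrix.toEuclideanCLM (𝕜 := ℝ) A x)) {g : Fin n → ℝ → ℝ}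
    (hg : ∀ i, Monotone (g i)) (f x y : EuclideanSpace ℝ (Fin n)) :
    c * ‖x - y‖ ≤ ‖residual A g f x - residual A g f y‖ := by
  refine le_norm_of_coercive ((hc (x - y)).trans ?_)
  rw [PiLp.inner_apply, PiLp.inner_apply]
  refine Finset.sum_le_sum fun i _ => ?_
  have h1 : (residual A g f x - residual A g f y) i = residual A g f x i - residual A g f y i :=
    PiLp.sub_apply ..
  rw [h1, residual_apply, residual_apply, map_sub]
  simp only [RCLike.inner_apply, conj_trivial, PiLp.sub_apply]
  have : 0 ≤ (g i (x i) - g i (y i)) * (x i - y i) := by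
    rcases le_total (x i) (y i) with h | h
    · exact mul_nonneg_of_nonpos_of_nonpos (sub_nonpos.2 (hg i h)) (sub_nonpos.2 h)
    · exact mul_nonneg (sub_nonneg.2 (hg i h)) (sub_nonneg.2 h)
  linarith

theorem hasFDerivAt_residual_apply (A : Matrix (Fin n) (Fin n) ℝ) {g : Fin n → ℝ → ℝ}
    (f : EuclideanSpace ℝ (Fin n)) {x : EuclideanSpace ℝ (Fin n)} {i : Fin n} {w : ℝ}
    (h : HasDerivAt (g i) w (x i)) :
    HasFDerivAt (fun z => residual A g f z i) (rowMap A i w) x := by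
  simp only [residual_apply]
  have h1 : HasFDerivAt (fun z : EuclideanSpace ℝ (Fin n) => Matrix.toEuclideanCLM (𝕜 := ℝ) A z i)
      ((EuclideanSpace.proj i : EuclideanSpace ℝ (Fin n) →L[ℝ] ℝ).comp
        (Matrix.toEuclideanCLM (𝕜 := ℝ) A)) x :=
    ((EuclideanSpace.proj i : EuclideanSpace ℝ (Fin n) →L[ℝ] ℝ).comp
        (Matrix.toEuclideanCLM (𝕜 := ℝ) A)).hasFDerivAt
  have h2 : HasFDerivAt (fun z : EuclideanSpace ℝ (Fin n) => g i (z i))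
      (w • (EuclideanSpace.proj i : EuclideanSpace ℝ (Fin n) →L[ℝ] ℝ)) x :=
    HasDerivAt.comp_hasFDerivAt x h
      (EuclideanSpace.proj i : EuclideanSpace ℝ (Fin n) →L[ℝ] ℝ).hasFDerivAt
  exact (h1.add h2).sub_const (f i)

theorem hasFDerivAt_residual (A : Matrix (Fin n) (Fin n) ℝ) {g : Fin n → ℝ → ℝ}
    (f : EuclideanSpace ℝ (Fin n)) {x : EuclideanSpace ℝ (Fin n)} {w : Fin n → ℝ}
    (h : ∀ i, HasDerivAt (g i) (w i) (x i)) : HasFDerivAt (residual A g f) (jac A w) x := by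
  refine hasFDerivWithinAt_univ.1 (hasFDerivWithinAt_euclidean.2 fun i => ?_)
  rw [proj_comp_jac]
  exact (hasFDerivAt_residual_apply A f (h i)).hasFDerivWithinAt

/-- Along the line through `x` in the `i`-th coordinate direction, the component is `g i` plus an
affine function. This identifies the differentiability points that enter the B-subdifferential. -/
theorem differentiableAt_of_residual_apply {A : Matrix (Fin n) (Fin n) ℝ} {g : Fin n → ℝ → ℝ}
    {f x : EuclideanSpace ℝ (Fin n)} {i : Fin n}
    (h : DifferentiableAt ℝ (fun z => residual A g f z i) x) : DifferentiableAt ℝ (g i) (x i) := by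
  obtain ⟨e, he⟩ : ∃ e, e = EuclideanSpace.single i (1 : ℝ) := ⟨_, rfl⟩
  obtain ⟨l, hl⟩ : ∃ l : ℝ → EuclideanSpace ℝ (Fin n), l = fun s => x + (s - x i) • e := ⟨_, rfl⟩
  have hli : ∀ s, l s i = s := fun s => by simp [hl, he]
  have hlx : l (x i) = x := by simp [hl]
  have hld : DifferentiableAt ℝ l (x i) := by rw [hl]; fun_prop
  have h1 : DifferentiableAt ℝ (fun s => residual A g f (l s) i) (x i) :=
    DifferentiableAt.comp (x i) (g := fun z => residual A g f z i) (by rwa [hlx]) hld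
  have h2 : DifferentiableAt ℝ (fun s => (EuclideanSpace.proj i : EuclideanSpace ℝ (Fin n) →L[ℝ] ℝ)
      (Matrix.toEuclideanCLM (𝕜 := ℝ) A (l s))) (x i) := by fun_prop
  have h3 := (h1.fun_sub h2).add_const (f i)
  refine h3.congr_of_eventuallyEq (Eventually.of_forall fun s => ?_)
  simp only [residual_apply, hli, PiLp.proj_apply]
  ring

/-! ### The generalized derivatives of the residual -/

section Subdifferential

variable {A : Matrix (Fin n) (Fin n) ℝ} {φ : Fin n → ℝ → ℝ} {f x : EuclideanSpace ℝ (Fin n)}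
  {i : Fin n} {r K pL pR : ℝ}

theorem rowMap_mem_bSubdifferential {u : ℕ → ℝ} {q : ℝ} (hu : Tendsto u atTop (𝓝 (x i)))
    (hd : ∀ k, DifferentiableAt ℝ (φ i) (u k))
    (hq : Tendsto (fun k => deriv (φ i) (u k)) atTop (𝓝 q)) :
    rowMap A i q ∈ bSubdifferential (fun z => residual A φ f z i) x := by
  obtain ⟨e, he⟩ : ∃ e, e = EuclideanSpace.single i (1 : ℝ) := ⟨_, rfl⟩
  have hyi : ∀ k, (x + (u k - x i) • e) i = u k := fun k => by simp [he]
  have hder : ∀ k, HasFDerivAt (fun z => residual A φ f z i) (rowMap A i (deriv (φ i) (u k)))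
      (x + (u k - x i) • e) := fun k =>
    hasFDerivAt_residual_apply A f (by rw [hyi]; exact (hd k).hasDerivAt)
  refine ⟨fun k => x + (u k - x i) • e, ?_, fun k => (hder k).differentiableAt, ?_⟩
  · simpa using tendsto_const_nhds.add ((hu.sub_const (x i)).smul_const e)
  · simp only [(hder _).fderiv]
    exact tendsto_const_nhds.add (hq.smul_const _)

theorem HasLocalSlopes.rowMap_left_mem (h : HasLocalSlopes (φ i) (x i) r K pL pR) :
    rowMap A i pL ∈ bSubdifferential (fun z => residual A φ f z i) x := by
  obtain ⟨u, -, hu, hlim⟩ := exists_seq_strictMono_tendsto'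
    (show x i - r < x i by linarith [h.r_pos])
  refine rowMap_mem_bSubdifferential hlim (fun k => ?_) (h.tendsto_left.comp ?_)
  · have := hu k
    exact h.differentiableAt _ (by rw [abs_lt]; constructor <;> linarith [this.1, this.2])
      this.2.ne
  · exact tendsto_nhdsWithin_iff.2 ⟨hlim, Eventually.of_forall fun k => (hu k).2⟩

theorem HasLocalSlopes.rowMap_right_mem (h : HasLocalSlopes (φ i) (x i) r K pL pR) :
    rowMap A i pR ∈ bSubdifferential (fun z => residual A φ f z i) x := by
  obtain ⟨u, -, hu, hlim⟩ := exists_seq_strictAnti_tendsto'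
    (show x i < x i + r by linarith [h.r_pos])
  refine rowMap_mem_bSubdifferential hlim (fun k => ?_) (h.tendsto_right.comp ?_)
  · have := hu k
    exact h.differentiableAt _ (by rw [abs_lt]; constructor <;> linarith [this.1, this.2])
      this.1.ne'
  · exact tendsto_nhdsWithin_iff.2 ⟨hlim, Eventually.of_forall fun k => (hu k).1⟩

theorem HasLocalSlopes.rowMap_mem (h : HasLocalSlopes (φ i) (x i) r K pL pR) {w : ℝ}
    (hw : w ∈ segment ℝ pL pR) :
    rowMap A i w ∈ convexHull ℝ (bSubdifferential (fun z => residual A φ f z i) x) := by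
  obtain ⟨a, b, ha, hb, hab, rfl⟩ := hw
  have h1 : rowMap A i (a • pL + b • pR) = a • rowMap A i pL + b • rowMap A i pR := by
    ext d
    simp only [add_apply, smul_apply, rowMap_apply, smul_eq_mul]
    linear_combination (-(Matrix.toEuclideanCLM (𝕜 := ℝ) A d i)) * hab
  rw [h1]
  exact convex_convexHull ℝ _ (subset_convexHull ℝ _ h.rowMap_left_mem)
    (subset_convexHull ℝ _ h.rowMap_right_mem) ha hb hab

theorem exists_eq_rowMap_of_mem_bSubdifferential {L : EuclideanSpace ℝ (Fin n) →L[ℝ] ℝ}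
    (hL : L ∈ bSubdifferential (fun z => residual A φ f z i) x) :
    ∃ w, L = rowMap A i w ∧ (ContinuousAt (deriv (φ i)) (x i) → w = deriv (φ i) (x i)) := by
  obtain ⟨y, hy, hd, hlim⟩ := hL
  have hyi : Tendsto (fun k => y k i) atTop (𝓝 (x i)) :=
    ((EuclideanSpace.proj i : EuclideanSpace ℝ (Fin n) →L[ℝ] ℝ).continuous.tendsto x).comp hy
  have hf : ∀ k, fderiv ℝ (fun z => residual A φ f z i) (y k) =
      rowMap A i (deriv (φ i) (y k i)) := fun k =>
    (hasFDerivAt_residual_apply A f (differentiableAt_of_residual_apply (hd k)).hasDerivAt).fderiv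
  simp only [hf] at hlim
  obtain ⟨e, he⟩ : ∃ e, e = EuclideanSpace.single i (1 : ℝ) := ⟨_, rfl⟩
  have hei : e i = 1 := by simp [he]
  -- Evaluation at the `i`-th unit vector recovers the scalar slopes, so convergence of the rows
  -- forces convergence of the slopes.
  have h1 : Tendsto (fun k => deriv (φ i) (y k i)) atTop
      (𝓝 (L e - Matrix.toEuclideanCLM (𝕜 := ℝ) A e i)) := by
    have h2 := (tendsto_clm_apply hlim (tendsto_const_nhds (x := e))).sub_const
      (Matrix.toEuclideanCLM (𝕜 := ℝ) A e i)
    refine h2.congr fun k => ?_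
    rw [rowMap_apply, hei]; ring
  refine ⟨_, tendsto_nhds_unique hlim (tendsto_const_nhds.add (h1.smul_const _)), fun hc => ?_⟩
  exact tendsto_nhds_unique h1 (hc.tendsto.comp hyi)

theorem exists_eq_rowMap_of_mem_convexHull {L : EuclideanSpace ℝ (Fin n) →L[ℝ] ℝ}
    (hL : L ∈ convexHull ℝ (bSubdifferential (fun z => residual A φ f z i) x)) :
    ∃ w, L = rowMap A i w ∧ (ContinuousAt (deriv (φ i)) (x i) → w = deriv (φ i) (x i)) := by
  refine convexHull_min (t := {L | ∃ w, L = rowMap A i w ∧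
    (ContinuousAt (deriv (φ i)) (x i) → w = deriv (φ i) (x i))})
    (fun L hL => exists_eq_rowMap_of_mem_bSubdifferential hL) ?_ hL
  rintro _ ⟨w, rfl, hw⟩ _ ⟨v, rfl, hv⟩ a b _ _ hab
  refine ⟨a * w + b * v, ?_, fun hc => ?_⟩
  · ext d
    simp only [add_apply, smul_apply, rowMap_apply, smul_eq_mul]
    linear_combination (Matrix.toEuclideanCLM (𝕜 := ℝ) A d i) * hab
  · rw [hw hc, hv hc, ← add_mul, hab, one_mul]

end Subdifferential

/-! ### Verification of the regularity properties for the residual. -/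

theorem exists_semismooth {A : Matrix (Fin n) (Fin n) ℝ} {φ : Fin n → ℝ → ℝ}
    (hφ : ∀ i, PiecewiseContDiff 2 (φ i)) (f z : EuclideanSpace ℝ (Fin n)) :
    ∃ r K : ℝ, 0 < r ∧ 0 < K ∧ ∀ x, ‖x - z‖ < r →
      ‖residual A φ f x - residual A φ f z‖ ≤ K * ‖x - z‖ ∧
      ∀ V ∈ cSubdifferential (residual A φ f) x,
        ‖V (x - z) - (residual A φ f x - residual A φ f z)‖ ≤ K * ‖x - z‖ ^ 2 := by
  choose r K pL pR h using fun i => (hφ i).exists_hasLocalSlopes (z i)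
  obtain ⟨r₀, hr₀, hr⟩ : ∃ r₀, 0 < r₀ ∧ ∀ i, r₀ ≤ r i := by
    have h1 : ∀ᶠ s in 𝓝[>] (0 : ℝ), ∀ i, s ≤ r i := eventually_all.2 fun i =>
      (eventually_le_nhds (h i).r_pos).filter_mono nhdsWithin_le_nhds
    obtain ⟨s, hs, hs0⟩ := (h1.and self_mem_nhdsWithin).exists
    exact ⟨s, hs0, hs⟩
  obtain ⟨M, hM⟩ : ∃ M, M = ‖Matrix.toEuclideanCLM (𝕜 := ℝ) A‖ := ⟨_, rfl⟩
  have hM0 : 0 ≤ M := hM ▸ norm_nonneg _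
  have hK : ∀ i, 0 < K i := fun i => (h i).K_pos
  have hS : 0 ≤ ∑ i, K i := Finset.sum_nonneg fun i _ => (hK i).le
  refine ⟨r₀, ∑ i, K i + M + 1, hr₀, by positivity, fun x hx => ?_⟩
  have hxi : ∀ i, |x i - z i| ≤ ‖x - z‖ := fun i => PiLp.norm_apply_le (x - z) i
  have hxr : ∀ i, |x i - z i| < r i := fun i => (hxi i).trans_lt (hx.trans_le (hr i))
  constructor
  · have h1 : residual A φ f x - residual A φ f z = Matrix.toEuclideanCLM (𝕜 := ℝ) A (x - z) +
        WithLp.toLp 2 (fun i => φ i (x i) - φ i (z i)) := by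
      ext i
      rw [PiLp.sub_apply, residual_apply, residual_apply, map_sub, PiLp.add_apply, PiLp.sub_apply]
      ring
    have h2 : ‖WithLp.toLp 2 (fun i => φ i (x i) - φ i (z i))‖ ≤ (∑ i, K i) * ‖x - z‖ := by
      refine (norm_le_sum_abs _).trans ?_
      rw [Finset.sum_mul]
      refine Finset.sum_le_sum fun i _ => ((h i).lipschitz _ (hxr i)).trans ?_
      have := hxi i
      have := (hK i).le
      gcongr
    have h3 := (Matrix.toEuclideanCLM (𝕜 := ℝ) A).le_opNorm (x - z)
    rw [← hM] at h3
    rw [h1]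
    refine (norm_add_le _ _).trans ?_
    nlinarith [norm_nonneg (x - z)]
  · intro V hV
    have h1 : ∀ i, |(V (x - z) - (residual A φ f x - residual A φ f z)) i| ≤
        K i * ‖x - z‖ ^ 2 := fun i => by
      obtain ⟨w, hw, hwd⟩ := exists_eq_rowMap_of_mem_convexHull (hV i)
      have h2 : V (x - z) i = rowMap A i w (x - z) := by rw [← hw]; simp
      rw [PiLp.sub_apply, PiLp.sub_apply, h2, rowMap_apply, residual_apply, residual_apply,
        map_sub, PiLp.sub_apply, PiLp.sub_apply]
      have h3 : ∀ a b c d e g : ℝ, a - b + e - (a + c - g - (b + d - g)) = e - (c - d) :=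
        fun _ _ _ _ _ _ => by ring
      rw [h3]
      have h4 : K i * |x i - z i| ^ 2 ≤ K i * ‖x - z‖ ^ 2 := by
        have := hxi i
        have := (hK i).le
        gcongr
      refine le_trans ?_ h4
      -- If the coordinates agree, the unknown slope `w` is multiplied by zero; otherwise `x i` is
      -- not a breakpoint and `w` is the derivative there.
      rcases eq_or_ne (x i) (z i) with he | hne
      · simp [he]
      · rw [hwd ((h i).continuousAt _ (hxr i) hne)]
        exact (h i).taylor _ (hxr i) hne
    refine (norm_le_sum_abs _).trans ((Finset.sum_le_sum fun i _ => h1 i).trans ?_)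
    rw [← Finset.sum_mul]
    gcongr
    linarith

/-- Rows of the C-subdifferential may be chosen independently, so each smoothed slope can be
replaced by a nearby point between the one-sided slopes of its own coordinate. -/
theorem consistent_of_isAdmissible {A : Matrix (Fin n) (Fin n) ℝ} {φ : Fin n → ℝ → ℝ}
    {ψ : Fin n → ℝ → ℝ → ℝ} (hφ : ∀ i, PiecewiseContDiff 2 (φ i))
    (hψ : ∀ i, IsAdmissible (φ i) (ψ i)) (f x : EuclideanSpace ℝ (Fin n)) {η : ℝ} (hη : 0 < η) :
    ∃ e₀ : ℝ, 0 < e₀ ∧ ∀ e : ℝ, 0 < e → e < e₀ →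
      Metric.infDist (fderiv ℝ (fun y => smoothResidual A ψ f y e) x)
        (cSubdifferential (residual A φ f) x) ≤ η := by
  choose r K pL pR h using fun i => (hφ i).exists_hasLocalSlopes (x i)
  -- The tolerance is shared among the `n` rows; `n + 1` also covers `n = 0`.
  have hη' : 0 < η / (n + 1) := by positivity
  have h1 : ∀ᶠ e in 𝓝[>] (0 : ℝ), ∀ i, ∃ w ∈ segment ℝ (pL i) (pR i),
      |deriv (fun s => ψ i s e) (x i) - w| ≤ η / (n + 1) :=
    eventually_all.2 fun i => (h i).eventually_deriv_near (hψ i) hη'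
  obtain ⟨e₀, he₀, hsub⟩ := mem_nhdsGT_iff_exists_Ioo_subset.1 h1
  refine ⟨e₀, he₀, fun e he hee => ?_⟩
  choose w hw hwd using hsub ⟨he, hee⟩
  have hmem : jac A w ∈ cSubdifferential (residual A φ f) x := fun i => by
    rw [proj_comp_jac]
    exact (h i).rowMap_mem (hw i)
  have hder : fderiv ℝ (fun y => smoothResidual A ψ f y e) x =
      jac A (fun i => deriv (fun s => ψ i s e) (x i)) :=
    (hasFDerivAt_residual A f fun i =>
      (((hψ i).smooth e he).differentiable one_ne_zero (x i)).hasDerivAt).fderiv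
  refine (Metric.infDist_le_dist_of_mem hmem).trans ?_
  rw [dist_eq_norm, hder]
  refine (norm_jac_sub_le _ _ _).trans ((Finset.sum_le_sum fun i _ => hwd i).trans ?_)
  rw [Finset.sum_const, Finset.card_univ, Fintype.card_fin, nsmul_eq_mul, mul_div_assoc',
    div_le_iff₀ (by positivity)]
  nlinarith

theorem isRegularSmoothing_residual {A : Matrix (Fin n) (Fin n) ℝ} {φ : Fin n → ℝ → ℝ}
    {ψ : Fin n → ℝ → ℝ → ℝ} {c : ℝ} (hc0 : 0 < c)
    (hc : ∀ x : EuclideanSpace ℝ (Fin n),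
      c * ‖x‖ ^ 2 ≤ inner ℝ x (Matrix.toEuclideanCLM (𝕜 := ℝ) A x))
    (hmono : ∀ i, Monotone (φ i)) (hφ : ∀ i, PiecewiseContDiff 2 (φ i))
    (hψ : ∀ i, IsAdmissible (φ i) (ψ i)) (f : EuclideanSpace ℝ (Fin n)) :
    IsRegularSmoothing (residual A φ f) (smoothResidual A ψ f) c where
  c_pos := hc0
  continuous := by
    have h1 : ∀ i, Continuous (φ i) := fun i => (hφ i).1
    unfold residual
    fun_prop
  expand := norm_sub_le_residual hc hmono f
  contDiff ε hε := by
    have h1 : ∀ i, ContDiff ℝ 1 (fun t => ψ i t ε) := fun i => (hψ i).smooth ε hε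
    rw [contDiff_euclidean]
    intro i
    simp only [smoothResidual, residual_apply]
    have h2 : ContDiff ℝ 1 (EuclideanSpace.proj i : EuclideanSpace ℝ (Fin n) →L[ℝ] ℝ) :=
      ContinuousLinearMap.contDiff _
    exact ((h2.comp (Matrix.toEuclideanCLM (𝕜 := ℝ) A).contDiff).add ((h1 i).comp h2)).sub
      contDiff_const
  expand_smooth ε hε := norm_sub_le_residual hc (fun i => (hψ i).monotone ε hε) f
  expand_fderiv ε hε x d := by
    have h1 := hasFDerivAt_residual A (g := fun i t => ψ i t ε) f (x := x) fun i =>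
      (((hψ i).smooth ε hε).differentiable one_ne_zero (x i)).hasDerivAt
    have h2 : fderiv ℝ (fun y => smoothResidual A ψ f y ε) x =
      jac A (fun i => deriv (fun t => ψ i t ε) (x i)) := h1.fderiv
    rw [h2]
    exact norm_le_jac hc (fun i => ((hψ i).monotone ε hε).deriv_nonneg) d
  nonempty x := by
    choose r K pL pR h using fun i => (hφ i).exists_hasLocalSlopes (x i)
    exact ⟨jac A pL, fun i => by
      rw [proj_comp_jac]
      exact (h i).rowMap_mem (left_mem_segment ℝ _ _)⟩
  consistent x _ hη := consistent_of_isAdmissible hφ hψ f x hη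
  semismooth z := exists_semismooth hφ f z

theorem exists_isSmoothingConstant {A : Matrix (Fin n) (Fin n) ℝ} {φ : Fin n → ℝ → ℝ}
    {ψ : Fin n → ℝ → ℝ → ℝ} (hψ : ∀ i, IsAdmissible (φ i) (ψ i))
    (f : EuclideanSpace ℝ (Fin n)) :
    ∃ μ, IsSmoothingConstant (residual A φ f) (smoothResidual A ψ f) μ := by
  choose μ hμ h using fun i => (hψ i).approx
  have hS : 0 ≤ ∑ i, μ i := Finset.sum_nonneg fun i _ => (hμ i).le
  refine ⟨∑ i, μ i + 1, by positivity, fun x ε hε => (norm_le_sum_abs _).trans ?_⟩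
  calc ∑ i, |(smoothResidual A ψ f x ε - residual A φ f x) i| ≤ ∑ i, μ i * ε := by
        refine Finset.sum_le_sum fun i _ => ?_
        rw [PiLp.sub_apply, smoothResidual, residual_apply, residual_apply]
        refine le_trans (le_of_eq ?_) (h i (x i) ε hε)
        congr 1
        ring
    _ ≤ (∑ i, μ i + 1) * ε := by
        rw [← Finset.sum_mul]
        nlinarith

end SmoothingNewton

end

theorem mainTheorem3 (n : ℕ) (A : Matrix (Fin n) (Fin n) ℝ) (hA : A.PosDef)
    (f : EuclideanSpace ℝ (Fin n)) (φ : Fin n → ℝ → ℝ)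
    (hmono : ∀ i, Monotone (φ i)) (hpc : ∀ i, SmoothingNewton.PiecewiseContDiff 2 (φ i))
    (ψ : Fin n → ℝ → ℝ → ℝ) (hadm : ∀ i, SmoothingNewton.IsAdmissible (φ i) (ψ i))
    (H : EuclideanSpace ℝ (Fin n) → EuclideanSpace ℝ (Fin n))
    (hH : H = SmoothingNewton.residual A φ f)
    (Ht : EuclideanSpace ℝ (Fin n) → ℝ → EuclideanSpace ℝ (Fin n))
    (hHt : Ht = SmoothingNewton.smoothResidual A ψ f) :
    (∃ μ : ℝ, SmoothingNewton.IsSmoothingConstant H Ht μ) ∧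
    ∃ xstar : EuclideanSpace ℝ (Fin n), H xstar = 0 ∧ (∀ y, H y = 0 → y = xstar) ∧
      ∀ p : SmoothingNewton.Params, p.Valid H Ht → ∀ x₀ : EuclideanSpace ℝ (Fin n),
        SmoothingNewton.WellDefined p H Ht x₀ ∧
        ∀ s : ℕ → SmoothingNewton.State n, SmoothingNewton.IsRun p H Ht x₀ s →
          Tendsto (fun k => (s k).x) atTop (𝓝 xstar) ∧
          ∃ C : ℝ, ∀ᶠ k in atTop, ‖(s (k + 1)).x - xstar‖ ≤ C * ‖(s k).x - xstar‖ ^ 2 := by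
  subst hH hHt
  obtain ⟨c, hc0, hc⟩ := SmoothingNewton.exists_coercive hA
  have hreg := SmoothingNewton.isRegularSmoothing_residual hc0 hc hmono hpc hadm f
  obtain ⟨μ, hμ⟩ := SmoothingNewton.exists_isSmoothingConstant hadm f
  obtain ⟨xs, hxs⟩ := hreg.exists_zero hμ
  exact ⟨⟨μ, hμ⟩, xs, hxs, fun y hy => hreg.eq_of_zero hxs hy, fun p hp x₀ =>
    ⟨SmoothingNewton.wellDefined hreg hp x₀, fun s hs => hs.convergence hreg hp hxs⟩⟩
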